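/- Let $n\ge 0$ be an integer and let $V,W:\mathbb{R}^n\to\mathbb{R}$ be $\mathcal C^2$ functions such that $\nabla^2V(x)\ge\alpha$ and $\nabla^2W(x)\ge\beta$ for all $x\in\mathbb{R}^n$, as quadratic forms, for some $\alpha,\beta\in\mathbb{R}$; assume moreover that $W$ is even. Let $P_2(\mathbb{R}^n)$ be the set of Borel probability measures $\mu$ on $\mathbb{R}^n$ with $\int|x|^2\,d\mu<\infty$, and let $$W_2(\mu,\nu)=\inf_\pi\Big(\iint|x-y|^2\,d\pi(x,y)\Big)^{1/2},$$ where $\pi$ runs over the Borel probability measures on $\mathbb{R}^n\times\mathbb{R}^n$ with marginals $\mu$ and $\nu$. For $\mu\in P_2(\mathbb{R}^n)$ that is absolutely continuous with respect to the Lebesgue measure, with density also denoted by $\mu$, let $$F(\mu)=\int_{\mathbb{R}^n}\mu\log\mu\,dx+\int_{\mathbb{R}^n}V\,d\mu+\frac12\iint_{\mathbb{R}^{2n}}W(x-y)\,d\mu(x)\,d\mu(y),$$ and let $F(\mu)=+\infty$ for all other $\mu\in P_2(\mathbb{R}^n)$. Then, in each of the following four cases, $F$ is a well-defined map from $P_2(\mathbb{R}^n)$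 to $\mathbb{R}\cup\{+\infty\}$ and attains its minimum on $P_2(\mathbb{R}^n)$, and this minimum is finite: (i) $V=0$, $W$ is convex, and there are $b,b'>0$ with $W(x)\ge b|x|^2-b'$ for all $x$; (ii) there are $a,a',b,b'>0$ with $V(x)\ge a|x|-a'$ and $W(x)\ge b|x|^2-b'$ for all $x$; (iii) there are $a,a',b'>0$ and a real number $b>-a$ with $V(x)\ge a|x|^2-a'$ and $W(x)\ge b|x|^2-b'$ for all $x$; (iv) $W$ is bounded from below, the measure $e^{-V}dx$ belongs to $P_2(\mathbb{R}^n)$, and it satisfies a Talagrand transportation inequality: there is $C>0$ such that $$W_2^2(\nu,e^{-V}dx)\le\frac2C\Big(\int\nu\log\nu\,dx+\int V\,d\nu\Big)\qquad\text{for all }\nu\in P_2(\mathbb{R}^n),$$ where $\int\nu\log\nu\,dx=+\infty$ if $\nu$ is not absolutely continuous. -/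

import Mathlib

open MeasureTheory
open scoped ENNReal

/-- The Borel probability measures on `ℝⁿ` with finite second moment. -/
def P2 (n : ℕ) : Set (Measure (EuclideanSpace ℝ (Fin n))) :=
  {μ | IsProbabilityMeasure μ ∧ ∫⁻ x, ‖x‖ₑ ^ 2 ∂μ < ∞}

/-- The Wasserstein distance of order two: the infimum of
`(∬ |x - y|² dπ(x, y)) ^ (1/2)` over all measures `π` with marginals `μ` and `ν`. -/
noncomputable def wasserstein2 {n : ℕ} (μ ν : Measure (EuclideanSpace ℝ (Fin n))) : ℝ≥0∞ :=
  ⨅ (π : Measure (EuclideanSpace ℝ (Fin n) × EuclideanSpace ℝ (Fin n)))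
    (_ : π.fst = μ ∧ π.snd = ν), (∫⁻ p, ‖p.1 - p.2‖ₑ ^ 2 ∂π) ^ (1 / 2 : ℝ)

/-- The integral of a real function with values in the extended reals: the integral of the positive
part minus the integral of the negative part. It is the usual integral as soon as one of the two is
finite; if both are infinite (so that the integral makes no sense) its value is `⊥`, and every sum
with this term is then `⊥` as well. -/
noncomputable def extIntegral {α : Type*} [MeasurableSpace α] (μ : Measure α) (f : α → ℝ) : EReal :=
  ((∫⁻ x, ENNReal.ofReal (f x) ∂μ : ℝ≥0∞) : EReal) -
    ((∫⁻ x, ENNReal.ofReal (-f x) ∂μ : ℝ≥0∞) : EReal)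

/-- The density of `μ` with respect to the Lebesgue measure. -/
noncomputable def density {n : ℕ} (μ : Measure (EuclideanSpace ℝ (Fin n))) :
    EuclideanSpace ℝ (Fin n) → ℝ :=
  fun x => (μ.rnDeriv volume x).toReal

open Classical in
/-- The entropy `∫ μ log μ dx`, equal to `+∞` if `μ` is not absolutely continuous. -/
noncomputable def entropy {n : ℕ} (μ : Measure (EuclideanSpace ℝ (Fin n))) : EReal :=
  if μ ≪ volume then extIntegral volume (fun x => density μ x * Real.log (density μ x)) else ⊤

open Classical in
/-- The free energy: `∫ μ log μ dx + ∫ V dμ + (1/2) ∬ W(x - y) dμ(x) dμ(y)` if `μ` is absolutely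
continuous, and `+∞` otherwise. -/
noncomputable def freeEnergy {n : ℕ} (V W : EuclideanSpace ℝ (Fin n) → ℝ)
    (μ : Measure (EuclideanSpace ℝ (Fin n))) : EReal :=
  if μ ≪ volume then
    entropy μ + extIntegral μ V +
      ((1 / 2 : ℝ) : EReal) * extIntegral (μ.prod μ) (fun p => W (p.1 - p.2))
  else ⊤

/-- The Hessian of `f` is bounded below by `c`, as a quadratic form, at every point. -/
def HessianGE {n : ℕ} (f : EuclideanSpace ℝ (Fin n) → ℝ) (c : ℝ) : Prop :=
  ∀ x v : EuclideanSpace ℝ (Fin n), c * ‖v‖ ^ 2 ≤ iteratedFDeriv ℝ 2 f x ![v, v]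

/-- The measure `e^{-V} dx`. -/
noncomputable def expNegMeasure {n : ℕ} (V : EuclideanSpace ℝ (Fin n) → ℝ) :
    Measure (EuclideanSpace ℝ (Fin n)) :=
  volume.withDensity (fun x => ENNReal.ofReal (Real.exp (-V x)))

/-- The Talagrand transportation inequality with constant `C` for the measure `e^{-V} dx`:
`W₂²(ν, e^{-V}) ≤ (2 / C) (∫ ν log ν dx + ∫ V dν)` for all `ν` in `P₂(ℝⁿ)`. -/
def Talagrand {n : ℕ} (V : EuclideanSpace ℝ (Fin n) → ℝ) (C : ℝ) : Prop :=
  ∀ ν ∈ P2 n, ((wasserstein2 ν (expNegMeasure V) ^ 2 : ℝ≥0∞) : EReal) ≤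
    ((2 / C : ℝ) : EReal) * (entropy ν + extIntegral ν V)

/-! The proof is the direct method, run on all probability measures with the weak topology. A
comparison potential `U` with `exp (-U)` integrable absorbs the entropy: `freeEnergy_eq` writes the
free energy as `klDiv μ (expNegMeasure U)`, plus a nonnegative excess, plus constants and the term
`(c + b) ∫ |x|² dμ - b |∫ x dμ|²` coming from quadratic lower bounds `c`, `b` of `V - U` and `W`.

The variational formula for `klDiv` makes it a supremum of weakly continuous functionals, hence
lower semicontinuous. A test function concentrated off a compact set gives tightness of its
sublevels, so Prokhorov's theorem makes them compact (`isCompact_klDiv_le`). Integrals of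
nonnegative continuous functions are also lower semicontinuous, and `exists_min_klDiv_add` yields a
minimizer among probability measures.

It remains to treat the moment term, which is not weakly continuous, and to show that the minimizer
has a finite second moment. In cases (i) and (iii), `U` grows linearly. With `d = c + b > 0`, the
moment term is `d ∫ |x|² + s |∫ x|²` minus `(b + s) |∫ x|²`. The first part is lower semicontinuous
and controls the second moment (`momentEnergy`). The second vanishes when `b + s = 0` (case (iii))
or on centered competitors, which suffice in case (i) by translation invariance. In cases (ii) and
(iv) no quadratic part is extracted (`exists_minimizer_of_isClosed`). In case (ii), finite
interaction energy forces a finite second moment by Fubini. In case (iv), `U = V` and Talagrand's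
inequality bounds the second moment on entropy sublevels, a bound preserved by weak limits. -/

/-! ### Variational formula and weak compactness for the relative entropy -/

section KLDuality

open InformationTheory Filter Topology BoundedContinuousFunction Set
open scoped NNReal

/-- The Fenchel-Young inequality between `klFun` and `exp - 1`. -/
lemma mul_le_klFun_add_exp {t : ℝ} (ht : 0 ≤ t) (s : ℝ) :
    t * s ≤ klFun t + (Real.exp s - 1) := by
  rcases ht.eq_or_lt with rfl | ht
  · simp [klFun_zero, Real.exp_nonneg]
  · have h := Real.add_one_le_exp (s - Real.log t)
    rw [Real.exp_sub, Real.exp_log ht, le_div_iff₀ ht] at h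
    rw [klFun_apply]
    nlinarith

variable {E : Type*} [MeasurableSpace E]

lemma integrable_of_abs_le {μ : Measure E} [IsFiniteMeasure μ] {f : E → ℝ} (hf : Measurable f)
    {L : ℝ} (hL : ∀ x, |f x| ≤ L) : Integrable f μ :=
  (integrable_const L).mono' hf.aestronglyMeasurable (ae_of_all _ hL)

lemma integrable_exp_sub_one {μ : Measure E} [IsFiniteMeasure μ] {f : E → ℝ} (hf : Measurable f)
    {L : ℝ} (hL : ∀ x, |f x| ≤ L) : Integrable (fun x => Real.exp (f x) - 1) μ := by
  refine Integrable.sub ?_ (integrable_const 1)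
  refine integrable_of_abs_le (Real.measurable_exp.comp hf) (L := Real.exp L) fun x => ?_
  simpa using (abs_le.1 (hL x)).2

/-- The variational lower bound of the relative entropy by a bounded test function. -/
lemma ofReal_integral_sub_le_klDiv {μ γ : Measure E} [IsFiniteMeasure μ] [IsFiniteMeasure γ]
    {f : E → ℝ} (hf : Measurable f) {L : ℝ} (hL : ∀ x, |f x| ≤ L) :
    ENNReal.ofReal (∫ x, f x ∂μ - ∫ x, (Real.exp (f x) - 1) ∂γ) ≤ klDiv μ γ := by
  rcases eq_or_ne (klDiv μ γ) ∞ with h | h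
  · simp [h]
  obtain ⟨hac, hint⟩ := klDiv_ne_top_iff.1 h
  rw [klDiv_eq_integral_klFun, if_pos ⟨hac, hint⟩]
  refine ENNReal.ofReal_le_ofReal ?_
  have hk := (integrable_klFun_rnDeriv_iff hac).2 hint
  have he := integrable_exp_sub_one (μ := γ) hf hL
  have hfi : Integrable (fun x => (μ.rnDeriv γ x).toReal • f x) γ :=
    (integrable_rnDeriv_smul_iff hac).2 (integrable_of_abs_le hf hL)
  rw [← integral_rnDeriv_smul hac, sub_le_iff_le_add, ← integral_add hk he]
  exact integral_mono hfi (hk.add he) fun x => mul_le_klFun_add_exp ENNReal.toReal_nonneg _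

lemma abs_exp_sub_exp_le {a b L : ℝ} (ha : |a| ≤ L) (hb : |b| ≤ L) :
    |Real.exp a - Real.exp b| ≤ Real.exp L * |a - b| := by
  wlog h : b ≤ a generalizing a b
  · rw [abs_sub_comm, abs_sub_comm a]
    exact this hb ha (le_of_not_ge h)
  rw [abs_of_nonneg (sub_nonneg.2 (Real.exp_le_exp.2 h)), abs_of_nonneg (sub_nonneg.2 h)]
  have h1 := Real.add_one_le_exp (b - a)
  have h2 : Real.exp b = Real.exp a * Real.exp (b - a) := by rw [← Real.exp_add]; ring_nf
  have h3 : Real.exp a ≤ Real.exp L := Real.exp_le_exp.2 (abs_le.1 ha).2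
  have h4 := Real.exp_pos a
  rw [h2]
  nlinarith

lemma abs_clamp_le {L : ℝ} (hL : 0 ≤ L) (t : ℝ) : |max (-L) (min L t)| ≤ L :=
  abs_le.2 ⟨le_max_left _ _, max_le (by linarith) (min_le_left _ _)⟩

lemma clamp_eq_self {L t : ℝ} (ht : |t| ≤ L) : max (-L) (min L t) = t := by
  rw [min_eq_right (abs_le.1 ht).2, max_eq_right (abs_le.1 ht).1]

lemma abs_clamp_sub_clamp_le (L s t : ℝ) :
    |max (-L) (min L s) - max (-L) (min L t)| ≤ |s - t| := by
  refine (abs_max_sub_max_le_max _ _ _ _).trans (max_le (by simp) ?_)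
  exact (abs_min_sub_min_le_max _ _ _ _).trans (by simp)

/-- The concave function `s ↦ t s - (exp s - 1)` is nonnegative at truncations of `log t`. -/
lemma mul_clamp_log_nonneg {t L : ℝ} (ht : 0 ≤ t) (hL : 0 ≤ L) :
    0 ≤ t * max (-L) (min L (Real.log t)) - (Real.exp (max (-L) (min L (Real.log t))) - 1) := by
  set s := max (-L) (min L (Real.log t)) with hs
  have h1 := Real.add_one_le_exp (-s)
  have h2 : Real.exp s * Real.exp (-s) = 1 := by rw [← Real.exp_add]; simp
  have h3 := Real.exp_pos s
  -- It then suffices that `s * exp s ≤ t * s`: the truncation `s` lies between `0` and `log t`, so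
  -- `t - exp s` has the sign of `s`.
  have key : (Real.exp s - 1) ≤ Real.exp s * s := by nlinarith
  rcases ht.eq_or_lt with rfl | ht
  · have : s = 0 := by simp [hs, hL]
    simp [this]
  rcases le_total 0 (Real.log t) with h0 | h0
  · have hs0 : 0 ≤ s := le_max_of_le_right (le_min hL h0)
    have hst : s ≤ Real.log t := max_le (by linarith) (min_le_right _ _)
    have : Real.exp s ≤ t := by rw [← Real.exp_log ht]; exact Real.exp_le_exp.2 hst
    nlinarith
  · have hs0 : s ≤ 0 := max_le (by linarith) ((min_le_right _ _).trans h0)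
    have hst : Real.log t ≤ s := by
      rw [hs, min_eq_right (h0.trans hL)]; exact le_max_right _ _
    have : t ≤ Real.exp s := by
      rw [← Real.exp_log ht]; exact Real.exp_le_exp.2 hst
    nlinarith

/-- The optimal `s` in the Fenchel-Young inequality is `log t`, reached once the truncation exceeds
`|log t|`. At `t = 0` the optimum is `-∞`, while `Real.log 0 = 0`; hence the explicit value `-n`
there. -/
lemma tendsto_mul_clamp_log {t : ℝ} (ht : 0 ≤ t) :
    Tendsto (fun n : ℕ => t * max (-(n : ℝ)) (min (n : ℝ) (Real.log t)) -
      (Real.exp (max (-(n : ℝ)) (min (n : ℝ) (if t = 0 then -(n : ℝ) else Real.log t))) - 1))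
      atTop (𝓝 (klFun t)) := by
  rcases ht.eq_or_lt with rfl | ht
  · have h : Tendsto (fun n : ℕ => 1 - Real.exp (-(n : ℝ))) atTop (𝓝 (1 - 0)) :=
      tendsto_const_nhds.sub
        (Real.tendsto_exp_neg_atTop_nhds_zero.comp tendsto_natCast_atTop_atTop)
    rw [klFun_zero]
    simpa [sub_eq_add_neg, add_comm] using h
  · refine tendsto_const_nhds.congr' ?_
    filter_upwards [eventually_ge_atTop ⌈|Real.log t|⌉₊] with n hn
    have hn' : |Real.log t| ≤ n := (Nat.le_ceil _).trans (by exact_mod_cast hn)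
    rw [if_neg ht.ne', clamp_eq_self hn', Real.exp_log ht, klFun_apply]
    ring

/-- If the variational functional is bounded by `M` over bounded continuous functions, then it is
bounded by `M` over bounded measurable functions. -/
lemma integral_sub_le_of_forall_boundedContinuous [TopologicalSpace E] [NormalSpace E]
    [BorelSpace E] {μ γ : Measure E} [IsFiniteMeasure μ] [IsFiniteMeasure γ]
    [(μ + γ).WeaklyRegular] {M : ℝ}
    (h : ∀ f : E →ᵇ ℝ, ∫ x, f x ∂μ - ∫ x, (Real.exp (f x) - 1) ∂γ ≤ M)
    {f : E → ℝ} (hf : Measurable f) {L : ℝ} (hL : ∀ x, |f x| ≤ L) :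
    ∫ x, f x ∂μ - ∫ x, (Real.exp (f x) - 1) ∂γ ≤ M := by
  rcases isEmpty_or_nonempty E with hE | ⟨⟨x₀⟩⟩
  · simpa [integral_of_isEmpty] using h 0
  have hL0 : 0 ≤ L := (abs_nonneg _).trans (hL x₀)
  refine le_of_forall_pos_le_add fun ε hε => ?_
  -- An `L¹` error `δ` costs at most `δ` in the linear term and `exp L * δ` in the exponential term.
  set δ := ε / (1 + Real.exp L) with hδ
  have hden : 0 < 1 + Real.exp L := by positivity
  -- Approximating in `L¹(μ + γ)` controls both integrals at once. Clamping `g` to `[-L, L]` does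
  -- not increase the error and makes `exp` Lipschitz on the relevant range.
  obtain ⟨g, hg, hgi⟩ := (integrable_of_abs_le (μ := μ + γ) hf
    hL).exists_boundedContinuous_integral_sub_le
    (ε := δ) (by positivity)
  let G : E →ᵇ ℝ := BoundedContinuousFunction.ofNormedAddCommGroup
    (fun x => max (-L) (min L (g x))) (by fun_prop) L (fun x => abs_clamp_le hL0 _)
  have hG : ∀ x, |G x| ≤ L := fun x => abs_clamp_le hL0 _
  have hGm : Measurable G := G.continuous.measurable
  have hGf : ∀ x, |f x - G x| ≤ ‖f x - g x‖ := fun x => by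
    have := abs_clamp_sub_clamp_le L (f x) (g x)
    rwa [clamp_eq_self (hL x)] at this
  have hi : Integrable (fun x => |f x - G x|) (μ + γ) :=
    ((integrable_of_abs_le hf hL).sub (integrable_of_abs_le hGm hG)).abs
  have hsum : ∫ x, |f x - G x| ∂μ + ∫ x, |f x - G x| ∂γ ≤ δ := by
    rw [← integral_add_measure hi.left_of_add_measure hi.right_of_add_measure]
    exact (integral_mono hi ((integrable_of_abs_le hf hL).sub hgi).norm hGf).trans hg
  have h1 : ∫ x, f x ∂μ ≤ ∫ x, G x ∂μ + ∫ x, |f x - G x| ∂μ := by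
    rw [← integral_add (integrable_of_abs_le hGm hG) hi.left_of_add_measure]
    exact integral_mono (integrable_of_abs_le hf hL)
      ((integrable_of_abs_le hGm hG).add hi.left_of_add_measure)
      fun x => by linarith [le_abs_self (f x - G x)]
  have h2 : ∫ x, (Real.exp (G x) - 1) ∂γ ≤
      ∫ x, (Real.exp (f x) - 1) ∂γ + Real.exp L * ∫ x, |f x - G x| ∂γ := by
    rw [← integral_const_mul, ← integral_add (integrable_exp_sub_one hf hL)
      (hi.right_of_add_measure.const_mul _)]
    refine integral_mono (integrable_exp_sub_one hGm hG)
      ((integrable_exp_sub_one hf hL).add (hi.right_of_add_measure.const_mul _)) fun x => ?_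
    have := abs_exp_sub_exp_le (hG x) (hL x)
    rw [abs_sub_comm (G x)] at this
    linarith [le_abs_self (Real.exp (G x) - Real.exp (f x))]
  have h3 := h G
  have h4 : 0 ≤ ∫ x, |f x - G x| ∂μ := integral_nonneg fun x => abs_nonneg _
  have h5 : 0 ≤ ∫ x, |f x - G x| ∂γ := integral_nonneg fun x => abs_nonneg _
  have h6 : δ * (1 + Real.exp L) = ε := by rw [hδ]; field_simp
  have h7 := Real.exp_pos L
  nlinarith [mul_nonneg h7.le h4]

/-- The bounded measurable test functions determine an upper bound of the relative entropy. -/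
lemma klDiv_le_ofReal_of_forall_bounded {μ γ : Measure E} [IsFiniteMeasure μ] [IsFiniteMeasure γ]
    {M : ℝ} (h : ∀ f : E → ℝ, Measurable f → ∀ L : ℝ, (∀ x, |f x| ≤ L) →
      ∫ x, f x ∂μ - ∫ x, (Real.exp (f x) - 1) ∂γ ≤ M) :
    klDiv μ γ ≤ ENNReal.ofReal M := by
  have hac : μ ≪ γ := by
    refine Measure.AbsolutelyContinuous.mk fun A hA hγA => ?_
    by_contra hμA
    have hpos : 0 < μ.real A := ENNReal.toReal_pos hμA (measure_ne_top _ _)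
    -- On a `γ`-null set `A` the test function `n * 1_A` costs nothing under `γ` and gives `n * μ A
    -- ≤ M` for every `n`.
    obtain ⟨n, hn⟩ := exists_nat_gt (M / μ.real A)
    have := h (A.indicator fun _ => (n : ℝ)) (measurable_const.indicator hA) n fun x => by
      by_cases hx : x ∈ A <;> simp [hx]
    have h0 : ∫ x, (Real.exp (A.indicator (fun _ => (n : ℝ)) x) - 1) ∂γ = 0 := by
      refine integral_eq_zero_of_ae ?_
      have : ∀ᵐ x ∂γ, x ∉ A := measure_eq_zero_iff_ae_notMem.1 hγA
      filter_upwards [this] with x hx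
      simp [hx]
    rw [h0, integral_indicator hA, setIntegral_const, smul_eq_mul, sub_zero] at this
    rw [div_lt_iff₀ hpos] at hn
    linarith [mul_comm (μ.real A) n]
  rw [klDiv_eq_lintegral_klFun_of_ac hac]
  set ρ : E → ℝ := fun x => (μ.rnDeriv γ x).toReal with hρ
  have hρm : Measurable ρ := (Measure.measurable_rnDeriv _ _).ennreal_toReal
  have hρ0 : ∀ x, 0 ≤ ρ x := fun x => ENNReal.toReal_nonneg
  -- Truncations of the optimal test function `log ρ`. Their integrands are nonnegative and converge
  -- to `klFun ρ`, so Fatou's lemma applies.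
  let f : ℕ → E → ℝ := fun n x =>
    max (-(n : ℝ)) (min (n : ℝ) (if ρ x = 0 then -(n : ℝ) else Real.log (ρ x)))
  have hfm : ∀ n, Measurable (f n) := fun n =>
    measurable_const.max (measurable_const.min
      (Measurable.ite (hρm (measurableSet_singleton 0)) measurable_const hρm.log))
  have hfL : ∀ n x, |f n x| ≤ n := fun n x => abs_clamp_le (Nat.cast_nonneg n) _
  have hfρ : ∀ n x, ρ x * f n x = ρ x * max (-(n : ℝ)) (min (n : ℝ) (Real.log (ρ x))) := by
    intro n x
    by_cases hx : ρ x = 0 <;> simp [f, hx]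
  have hnn : ∀ n x, 0 ≤ ρ x * f n x - (Real.exp (f n x) - 1) := by
    intro n x
    by_cases hx : ρ x = 0
    · have : Real.exp (f n x) ≤ 1 := Real.exp_le_one_iff.2 (by simp [f, hx])
      simp only [hx, zero_mul]; linarith
    · have := mul_clamp_log_nonneg (hρ0 x) (Nat.cast_nonneg (α := ℝ) n)
      simpa [f, hx] using this
  have hlim : ∀ x, Tendsto (fun n => ENNReal.ofReal (ρ x * f n x - (Real.exp (f n x) - 1))) atTop
      (𝓝 (ENNReal.ofReal (klFun (ρ x)))) := fun x => by
    refine ENNReal.tendsto_ofReal ?_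
    simpa only [hfρ] using tendsto_mul_clamp_log (hρ0 x)
  calc ∫⁻ x, ENNReal.ofReal (klFun (ρ x)) ∂γ
      = ∫⁻ x, liminf (fun n => ENNReal.ofReal (ρ x * f n x - (Real.exp (f n x) - 1))) atTop ∂γ :=
        lintegral_congr fun x => (hlim x).liminf_eq.symm
    _ ≤ liminf (fun n => ∫⁻ x, ENNReal.ofReal (ρ x * f n x - (Real.exp (f n x) - 1)) ∂γ) atTop :=
        lintegral_liminf_le fun n => by have := hfm n; fun_prop
    _ ≤ liminf (fun _ : ℕ => ENNReal.ofReal M) atTop := by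
        refine liminf_le_liminf (Eventually.of_forall fun n => ?_)
        have hi1 : Integrable (fun x => ρ x * f n x) γ :=
          (integrable_rnDeriv_smul_iff hac).2 (integrable_of_abs_le (hfm n) (hfL n))
        have hi2 := integrable_exp_sub_one (μ := γ) (hfm n) (hfL n)
        have hi : Integrable (fun x => ρ x * f n x - (Real.exp (f n x) - 1)) γ := hi1.sub hi2
        rw [← ofReal_integral_eq_lintegral_ofReal hi (ae_of_all _ (hnn n))]
        refine ENNReal.ofReal_le_ofReal ?_
        have h1 : ∫ x, ρ x * f n x ∂γ = ∫ x, f n x ∂μ := integral_rnDeriv_smul hac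
        have := h (f n) (hfm n) n (hfL n)
        rw [← h1, ← integral_sub hi1 hi2] at this
        exact this
    _ = ENNReal.ofReal M := by simp

section Topological

variable [TopologicalSpace E] [BorelSpace E]

/-- The variational formula for the relative entropy. -/
lemma klDiv_eq_iSup_boundedContinuous [NormalSpace E] {μ γ : Measure E} [IsFiniteMeasure μ]
    [IsFiniteMeasure γ] [(μ + γ).WeaklyRegular] :
    klDiv μ γ = ⨆ f : E →ᵇ ℝ,
      ENNReal.ofReal (∫ x, f x ∂μ - ∫ x, (Real.exp (f x) - 1) ∂γ) := by
  refine le_antisymm ?_ (iSup_le fun f =>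
    ofReal_integral_sub_le_klDiv f.continuous.measurable f.norm_coe_le_norm)
  rcases eq_or_ne (⨆ f : E →ᵇ ℝ,
      ENNReal.ofReal (∫ x, f x ∂μ - ∫ x, (Real.exp (f x) - 1) ∂γ)) ∞ with h | h
  · simp [h]
  rw [← ENNReal.ofReal_toReal h]
  refine klDiv_le_ofReal_of_forall_bounded fun f hf L hL =>
    integral_sub_le_of_forall_boundedContinuous (fun g => ?_) hf hL
  rw [← ENNReal.ofReal_le_iff_le_toReal h]
  exact le_iSup (fun f : E →ᵇ ℝ =>
    ENNReal.ofReal (∫ x, f x ∂μ - ∫ x, (Real.exp (f x) - 1) ∂γ)) g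

lemma continuous_integral_probabilityMeasure (f : E →ᵇ ℝ) :
    Continuous fun μ : ProbabilityMeasure E => ∫ x, f x ∂(μ : Measure E) :=
  (FiniteMeasure.continuous_integral_boundedContinuousFunction f).comp
    ProbabilityMeasure.toFiniteMeasure_continuous

/-- By monotone convergence the integral is the supremum over `N` of the integrals of the bounded
continuous functions `min h⁺ N`, each weakly continuous in the measure. -/
lemma lowerSemicontinuous_lintegral {h : E → ℝ} (hh : Continuous h) :
    LowerSemicontinuous fun μ : ProbabilityMeasure E =>
      ∫⁻ x, ENNReal.ofReal (h x) ∂(μ : Measure E) := by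
  let g : ℕ → E →ᵇ ℝ≥0 := fun N => BoundedContinuousFunction.mkOfBound
    ⟨fun x => min (h x).toNNReal N, by fun_prop⟩ N fun x y => by
      rw [NNReal.dist_eq]
      refine abs_sub_le_of_nonneg_of_le (by positivity) ?_ (by positivity) ?_ <;>
        exact_mod_cast min_le_right _ _
  have key : ∀ μ : ProbabilityMeasure E, ∫⁻ x, ENNReal.ofReal (h x) ∂(μ : Measure E) =
      ⨆ N, ∫⁻ x, g N x ∂(μ : Measure E) := fun μ => by
    rw [← lintegral_iSup (f := fun N x => (g N x : ℝ≥0∞))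
      (fun N => (g N).continuous.measurable.coe_nnreal_ennreal)
      (fun N N' hN x => ENNReal.coe_le_coe.2 (min_le_min_left _ (by exact_mod_cast hN)))]
    refine lintegral_congr fun x => le_antisymm ?_ (iSup_le fun N =>
      ENNReal.coe_le_coe.2 (min_le_left _ _))
    refine le_iSup_of_le ⌈(h x).toNNReal⌉₊ ?_
    exact ENNReal.coe_le_coe.2 (le_min le_rfl (Nat.le_ceil _))
  simp_rw [key]
  exact lowerSemicontinuous_iSup fun N => Continuous.lowerSemicontinuous
    ((FiniteMeasure.continuous_lintegral_boundedContinuousFunction (g N)).comp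
      ProbabilityMeasure.toFiniteMeasure_continuous)

end Topological

section Polish

variable [TopologicalSpace E] [BorelSpace E] [PolishSpace E]

lemma lowerSemicontinuous_klDiv (γ : Measure E) [IsFiniteMeasure γ] :
    LowerSemicontinuous fun μ : ProbabilityMeasure E => klDiv (μ : Measure E) γ := by
  let := TopologicalSpace.upgradeIsCompletelyMetrizable E
  simp_rw [klDiv_eq_iSup_boundedContinuous]
  exact lowerSemicontinuous_iSup fun f => Continuous.lowerSemicontinuous
    (ENNReal.continuous_ofReal.comp
      ((continuous_integral_probabilityMeasure f).sub continuous_const))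

/-- The test function `L * 1_{Kᶜ}` gives `L μ(Kᶜ) ≤ M + (exp L - 1) γ(Kᶜ)`. If `γ(Kᶜ) ≤ exp (-L)`
the right side is at most `M + 1`, so a large `L` makes `μ(Kᶜ)` uniformly small. -/
lemma isTightMeasureSet_klDiv_le (γ : Measure E) [IsFiniteMeasure γ] {M : ℝ≥0∞} (hM : M ≠ ∞) :
    IsTightMeasureSet {((μ : ProbabilityMeasure E) : Measure E) |
      μ ∈ {μ : ProbabilityMeasure E | klDiv (μ : Measure E) γ ≤ M}} := by
  let := TopologicalSpace.upgradeIsCompletelyMetrizable E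
  rw [isTightMeasureSet_iff_exists_isCompact_measure_compl_le]
  intro ε hε
  wlog hε' : ε ≠ ∞ generalizing ε
  · obtain ⟨K, hK, h⟩ := this 1 one_pos ENNReal.one_ne_top
    rw [not_not] at hε'
    exact ⟨K, hK, fun μ _ => by simp [hε']⟩
  obtain ⟨e, he, rfl⟩ : ∃ e : ℝ, 0 < e ∧ ε = ENNReal.ofReal e :=
    ⟨ε.toReal, ENNReal.toReal_pos hε.ne' hε', (ENNReal.ofReal_toReal hε').symm⟩
  obtain ⟨L, hL⟩ := exists_gt ((M.toReal + 1) / e)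
  have hL0 : 0 < L := lt_of_le_of_lt (by positivity) hL
  rw [div_lt_iff₀ he] at hL
  obtain ⟨K, hK, hKγ⟩ := isTightMeasureSet_iff_exists_isCompact_measure_compl_le.1
    (isTightMeasureSet_singleton (μ := γ)) (ENNReal.ofReal (Real.exp (-L))) (by positivity)
  refine ⟨K, hK, ?_⟩
  rintro _ ⟨μ, hμ, rfl⟩
  have hA : MeasurableSet Kᶜ := hK.isClosed.measurableSet.compl
  have h1 := (ofReal_integral_sub_le_klDiv (μ := (μ : Measure E)) (γ := γ)
    (f := Kᶜ.indicator fun _ => L) (measurable_const.indicator hA) (L := L) fun x => by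
      by_cases hx : x ∈ K <;> simp [hx, hL0.le, abs_of_pos hL0]).trans hμ
  have hexp : (fun x => Real.exp (Kᶜ.indicator (fun _ => L) x) - 1) =
      Kᶜ.indicator fun _ => Real.exp L - 1 := by
    ext x; by_cases hx : x ∈ K <;> simp [hx]
  rw [ENNReal.ofReal_le_iff_le_toReal hM, hexp, integral_indicator hA, integral_indicator hA,
    setIntegral_const, setIntegral_const, smul_eq_mul, smul_eq_mul] at h1
  have h2 : γ.real Kᶜ ≤ Real.exp (-L) :=
    ENNReal.toReal_le_of_le_ofReal (Real.exp_nonneg _) (hKγ γ rfl)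
  have h3 : Real.exp (-L) * Real.exp L = 1 := by rw [← Real.exp_add]; simp
  have h4 : γ.real Kᶜ * (Real.exp L - 1) ≤ 1 := by
    nlinarith [Real.exp_pos L, Real.exp_pos (-L), measureReal_nonneg (μ := γ) (s := Kᶜ)]
  have h5 : (μ : Measure E).real Kᶜ ≤ e := by
    by_contra hcon
    rw [not_le] at hcon
    nlinarith
  rw [← ENNReal.ofReal_toReal (measure_ne_top (μ : Measure E) Kᶜ)]
  exact ENNReal.ofReal_le_ofReal h5

lemma isCompact_klDiv_le (γ : Measure E) [IsFiniteMeasure γ] {M : ℝ≥0∞} (hM : M ≠ ∞) :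
    IsCompact {μ : ProbabilityMeasure E | klDiv (μ : Measure E) γ ≤ M} := by
  have hcl : IsClosed {μ : ProbabilityMeasure E | klDiv (μ : Measure E) γ ≤ M} :=
    (lowerSemicontinuous_klDiv γ).isClosed_preimage M
  rw [← hcl.closure_eq]
  exact isCompact_closure_of_isTightMeasureSet (isTightMeasureSet_klDiv_le γ hM)

/-- The direct method for the sum of a relative entropy and a lower semicontinuous functional. -/
lemma exists_min_klDiv_add (γ : Measure E) [IsFiniteMeasure γ]
    {R : ProbabilityMeasure E → ℝ≥0∞} (hR : LowerSemicontinuous R)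
    {S : Set (ProbabilityMeasure E)} (hS : IsClosed S) {μ₀ : ProbabilityMeasure E} (hμ₀ : μ₀ ∈ S)
    (hfin : klDiv (μ₀ : Measure E) γ + R μ₀ ≠ ∞) :
    ∃ μ ∈ S, klDiv (μ : Measure E) γ + R μ ≠ ∞ ∧
      ∀ ν ∈ S, klDiv (μ : Measure E) γ + R μ ≤ klDiv (ν : Measure E) γ + R ν := by
  set J : ProbabilityMeasure E → ℝ≥0∞ := fun μ => klDiv (μ : Measure E) γ + R μ with hJ
  have hJl : LowerSemicontinuous J := (lowerSemicontinuous_klDiv γ).add hR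
  have hle : ∀ μ : ProbabilityMeasure E, klDiv (μ : Measure E) γ ≤ J μ := fun μ => le_self_add
  -- As `R ≥ 0`, every measure doing at least as well as `μ₀` lies in this compact entropy sublevel.
  obtain ⟨μ, ⟨-, hμ⟩, hmin⟩ := LowerSemicontinuousOn.exists_isMinOn
    (s := {μ : ProbabilityMeasure E | klDiv (μ : Measure E) γ ≤ J μ₀} ∩ S)
    ⟨μ₀, hle μ₀, hμ₀⟩ ((isCompact_klDiv_le γ hfin).inter_right hS)
    (hJl.lowerSemicontinuousOn _)
  have h0 : J μ ≤ J μ₀ := hmin ⟨hle μ₀, hμ₀⟩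
  refine ⟨μ, hμ, ne_top_of_le_ne_top hfin h0, fun ν hν => ?_⟩
  rcases le_total (J ν) (J μ₀) with h | h
  · exact hmin ⟨(hle ν).trans h, hν⟩
  · exact h0.trans h

end Polish

end KLDuality

/-! ### Extended integrals of functions with an integrable minorant -/

section ExtendedIntegral

variable {α : Type*} [MeasurableSpace α] {μ : Measure α}

lemma extIntegral_eq_integral {f : α → ℝ} (hf : Integrable f μ) :
    extIntegral μ f = ((∫ x, f x ∂μ : ℝ) : EReal) := by
  have h1 : ∫⁻ x, ENNReal.ofReal (f x) ∂μ ≠ ∞ := hf.lintegral_lt_top.ne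
  have h2 : ∫⁻ x, ENNReal.ofReal (-f x) ∂μ ≠ ∞ := hf.neg.lintegral_lt_top.ne
  rw [extIntegral, integral_eq_lintegral_pos_part_sub_lintegral_neg_part hf,
    ← EReal.coe_ennreal_toReal h1, ← EReal.coe_ennreal_toReal h2, EReal.coe_sub]

lemma extIntegral_eq_top {f : α → ℝ} (hf : AEStronglyMeasurable f μ)
    (hneg : ∫⁻ x, ENNReal.ofReal (-f x) ∂μ ≠ ∞) (hint : ¬ Integrable f μ) :
    extIntegral μ f = ⊤ := by
  have hpos : ∫⁻ x, ENNReal.ofReal (f x) ∂μ = ∞ := by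
    by_contra hpos
    refine hint ⟨hf, ?_⟩
    have : ∀ x, ‖f x‖ₑ = ENNReal.ofReal (f x) + ENNReal.ofReal (-f x) := fun x => by
      rw [Real.enorm_eq_ofReal_abs]
      rcases le_total 0 (f x) with h | h
      · rw [abs_of_nonneg h, ENNReal.ofReal_of_nonpos (neg_nonpos.2 h), add_zero]
      · rw [abs_of_nonpos h, ENNReal.ofReal_of_nonpos h, zero_add]
    rw [HasFiniteIntegral, lintegral_congr this,
      lintegral_add_left' hf.aemeasurable.ennreal_ofReal]
    exact ENNReal.add_lt_top.2 ⟨lt_top_iff_ne_top.2 hpos, lt_top_iff_ne_top.2 hneg⟩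
  rw [extIntegral, hpos, ← EReal.coe_ennreal_toReal hneg]
  rfl

/-- The extended integral of a function with an integrable minorant. -/
lemma extIntegral_eq_lintegral_add {f g : α → ℝ} (hf : AEStronglyMeasurable f μ)
    (hg : Integrable g μ) (hgf : ∀ x, g x ≤ f x) :
    extIntegral μ f =
      ((∫⁻ x, ENNReal.ofReal (f x - g x) ∂μ : ℝ≥0∞) : EReal) + ((∫ x, g x ∂μ : ℝ) : EReal) := by
  have hnn : ∀ x, 0 ≤ f x - g x := fun x => sub_nonneg.2 (hgf x)
  by_cases hi : Integrable f μ
  · have hs : Integrable (fun x => f x - g x) μ := hi.sub hg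
    rw [extIntegral_eq_integral hi, ← ofReal_integral_eq_lintegral_ofReal hs (ae_of_all _ hnn),
      EReal.coe_ennreal_ofReal, max_eq_left (integral_nonneg hnn), integral_sub hi hg,
      ← EReal.coe_add, sub_add_cancel]
  · have hneg : ∫⁻ x, ENNReal.ofReal (-f x) ∂μ ≠ ∞ := by
      refine ne_top_of_le_ne_top hg.neg.lintegral_lt_top.ne (lintegral_mono fun x => ?_)
      exact ENNReal.ofReal_le_ofReal (neg_le_neg (hgf x))
    have htop : ∫⁻ x, ENNReal.ofReal (f x - g x) ∂μ = ∞ := by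
      by_contra h
      have hs : Integrable (fun x => f x - g x) μ :=
        (lintegral_ofReal_ne_top_iff_integrable (hf.sub hg.1) (ae_of_all _ hnn)).1 h
      exact hi ((hs.add hg).congr (ae_of_all _ fun x => by simp))
    rw [extIntegral_eq_top hf hneg hi, htop]
    rfl

lemma ereal_add_add_add (x y : ℝ≥0∞) (r s : ℝ) :
    ((x : EReal) + (r : EReal)) + ((y : EReal) + (s : EReal)) =
      ((x + y : ℝ≥0∞) : EReal) + ((r + s : ℝ) : EReal) := by
  rw [EReal.coe_ennreal_add, EReal.coe_add, add_add_add_comm]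

lemma ereal_coe_ennreal_add_coe_ne_bot (x : ℝ≥0∞) (r : ℝ) : (x : EReal) + (r : EReal) ≠ ⊥ :=
  EReal.add_ne_bot_iff.2 ⟨EReal.coe_ennreal_ne_bot x, EReal.coe_ne_bot r⟩

lemma half_mul_ereal_add (x : ℝ≥0∞) (r : ℝ) :
    ((1 / 2 : ℝ) : EReal) * ((x : EReal) + (r : EReal)) =
      ((2⁻¹ * x : ℝ≥0∞) : EReal) + ((r / 2 : ℝ) : EReal) := by
  rcases eq_or_ne x ∞ with rfl | hx
  · rw [ENNReal.mul_top (by simp), EReal.coe_ennreal_top, EReal.top_add_coe,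
      EReal.coe_mul_top_of_pos (by norm_num), EReal.top_add_coe]
  · rw [← EReal.coe_ennreal_toReal hx, ← EReal.coe_ennreal_toReal (ENNReal.mul_ne_top (by simp) hx),
      ← EReal.coe_add, ← EReal.coe_mul, ← EReal.coe_add, ENNReal.toReal_mul]
    congr 1
    simp
    ring

lemma extIntegral_ne_bot {f g : α → ℝ} (hf : AEStronglyMeasurable f μ)
    (hg : Integrable g μ) (hgf : ∀ x, g x ≤ f x) : extIntegral μ f ≠ ⊥ := by
  rw [extIntegral_eq_lintegral_add hf hg hgf]
  exact ereal_coe_ennreal_add_coe_ne_bot _ _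

/-- The integrable minorants exclude `∞ - ∞`: each side is a nonnegative integral plus a finite
constant. -/
lemma extIntegral_add {f₁ f₂ g₁ g₂ : α → ℝ} (hf₁ : AEStronglyMeasurable f₁ μ)
    (hf₂ : AEStronglyMeasurable f₂ μ) (hg₁ : Integrable g₁ μ) (hg₂ : Integrable g₂ μ)
    (h₁ : ∀ x, g₁ x ≤ f₁ x) (h₂ : ∀ x, g₂ x ≤ f₂ x) :
    extIntegral μ (fun x => f₁ x + f₂ x) = extIntegral μ f₁ + extIntegral μ f₂ := by
  have hf : AEStronglyMeasurable (fun x => f₁ x + f₂ x) μ := hf₁.add hf₂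
  have hg : Integrable (fun x => g₁ x + g₂ x) μ := hg₁.add hg₂
  have hm : AEMeasurable (fun x => ENNReal.ofReal (f₁ x - g₁ x)) μ :=
    (hf₁.sub hg₁.1).aemeasurable.ennreal_ofReal
  rw [extIntegral_eq_lintegral_add hf₁ hg₁ h₁, extIntegral_eq_lintegral_add hf₂ hg₂ h₂,
    extIntegral_eq_lintegral_add hf hg (fun x => add_le_add (h₁ x) (h₂ x)), ereal_add_add_add,
    ← lintegral_add_left' hm]
  rw [integral_add hg₁ hg₂]
  congr 3
  ext x
  rw [← ENNReal.ofReal_add (sub_nonneg.2 (h₁ x)) (sub_nonneg.2 (h₂ x))]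
  ring_nf

end ExtendedIntegral

/-! ### Second moments and the quadratic interaction -/

section SecondMoment

open RealInnerProductSpace

variable {n : ℕ} {μ : Measure (EuclideanSpace ℝ (Fin n))}

lemma ofReal_norm_sq {E : Type*} [SeminormedAddCommGroup E] (x : E) :
    ENNReal.ofReal (‖x‖ ^ 2) = ‖x‖ₑ ^ 2 := by
  rw [ENNReal.ofReal_pow (norm_nonneg x), ofReal_norm]

lemma integrable_norm_sq_of_mem_P2 (hμ : μ ∈ P2 n) : Integrable (fun x => ‖x‖ ^ 2) μ := by
  refine (lintegral_ofReal_ne_top_iff_integrable (by fun_prop)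
    (ae_of_all _ fun x => by positivity)).1 ?_
  simpa only [ofReal_norm_sq] using hμ.2.ne

lemma integrable_norm_of_mem_P2 (hμ : μ ∈ P2 n) : Integrable (fun x => ‖x‖) μ := by
  have := hμ.1
  refine ((integrable_const (1 : ℝ)).add (integrable_norm_sq_of_mem_P2 hμ)).mono'
    (by fun_prop) (ae_of_all _ fun x => ?_)
  simp only [Pi.add_apply, norm_norm]
  nlinarith [sq_nonneg (‖x‖ - 1), sq_nonneg ‖x‖]

lemma integrable_id_of_mem_P2 (hμ : μ ∈ P2 n) : Integrable (fun x => x) μ :=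
  (integrable_norm_iff (by fun_prop)).1 (integrable_norm_of_mem_P2 hμ)

lemma integrable_quadratic_of_mem_P2 (hμ : μ ∈ P2 n) (a k : ℝ) :
    Integrable (fun x => a * ‖x‖ ^ 2 - k) μ := by
  have := hμ.1
  exact ((integrable_norm_sq_of_mem_P2 hμ).const_mul a).sub (integrable_const k)

lemma integral_quadratic_of_mem_P2 (hμ : μ ∈ P2 n) (a k : ℝ) :
    ∫ x, (a * ‖x‖ ^ 2 - k) ∂μ = a * ∫ x, ‖x‖ ^ 2 ∂μ - k := by
  have := hμ.1
  rw [integral_sub ((integrable_norm_sq_of_mem_P2 hμ).const_mul a) (integrable_const k),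
    integral_const_mul]
  simp

lemma integrable_norm_sub_sq_prod (hμ : μ ∈ P2 n) :
    Integrable (fun p => ‖p.1 - p.2‖ ^ 2) (μ.prod μ) := by
  have := hμ.1
  have h1 := (integrable_norm_sq_of_mem_P2 hμ).comp_fst μ
  have h2 := (integrable_norm_sq_of_mem_P2 hμ).comp_snd μ
  refine ((h1.const_mul 2).add (h2.const_mul 2)).mono' (by fun_prop) (ae_of_all _ fun p => ?_)
  rw [Real.norm_of_nonneg (by positivity)]
  have := parallelogram_law_with_norm ℝ p.1 p.2
  simp only [Pi.add_apply]
  nlinarith [sq_nonneg ‖p.1 + p.2‖]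

lemma integral_norm_sub_sq_prod (hμ : μ ∈ P2 n) :
    ∫ p, ‖p.1 - p.2‖ ^ 2 ∂(μ.prod μ) = 2 * ∫ x, ‖x‖ ^ 2 ∂μ - 2 * ‖∫ x, x ∂μ‖ ^ 2 := by
  have := hμ.1
  have hsq := integrable_norm_sq_of_mem_P2 hμ
  have hid := integrable_id_of_mem_P2 hμ
  rw [integral_prod _ (integrable_norm_sub_sq_prod hμ)]
  have h : ∀ x : EuclideanSpace ℝ (Fin n), ∫ y, ‖x - y‖ ^ 2 ∂μ =
      ‖x‖ ^ 2 - 2 * ⟪x, ∫ y, y ∂μ⟫ + ∫ y, ‖y‖ ^ 2 ∂μ := fun x => by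
    have hin : Integrable (fun y => ⟪x, y⟫) μ := hid.const_inner x
    have hs : Integrable (fun y => ‖x‖ ^ 2 - 2 * ⟪x, y⟫) μ :=
      (integrable_const _).sub (hin.const_mul 2)
    simp_rw [norm_sub_sq_real]
    rw [integral_add hs hsq, integral_sub (integrable_const _) (hin.const_mul 2), integral_const_mul,
      integral_inner hid]
    simp
  simp_rw [h]
  have hin : Integrable (fun x => ⟪x, ∫ y, y ∂μ⟫) μ := hid.inner_const _
  have hs : Integrable (fun x => ‖x‖ ^ 2 - 2 * ⟪x, ∫ y, y ∂μ⟫) μ := hsq.sub (hin.const_mul 2)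
  rw [integral_add hs (integrable_const _),
    integral_sub hsq (hin.const_mul 2), integral_const_mul]
  have h2 : ∫ x, ⟪x, ∫ y, y ∂μ⟫ ∂μ = ‖∫ y, y ∂μ‖ ^ 2 := by
    rw [← real_inner_self_eq_norm_sq, ← integral_inner hid]
    exact integral_congr_ae (ae_of_all _ fun x => real_inner_comm _ _)
  rw [h2]
  simp
  ring

end SecondMoment

/-- Compare with `(1 + |x|)^(-(n+1))`, integrable in dimension `n`: `exp (a|x|)` is the `(n+1)`-st
power of `exp (a|x|/(n+1)) ≥ 1 + a|x|/(n+1) ≥ δ (1 + |x|)`. -/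
lemma integrable_exp_neg_mul_norm {n : ℕ} {a : ℝ} (ha : 0 < a) :
    Integrable fun x : EuclideanSpace ℝ (Fin n) => Real.exp (-(a * ‖x‖)) := by
  set δ := min 1 (a / (n + 1 : ℝ)) with hδ
  have hδ0 : 0 < δ := lt_min one_pos (by positivity)
  have hr : (Module.finrank ℝ (EuclideanSpace ℝ (Fin n)) : ℝ) < (n + 1 : ℕ) := by simp
  refine ((integrable_one_add_norm hr).const_mul ((δ ^ (n + 1))⁻¹)).mono' (by fun_prop)
    (ae_of_all _ fun x => ?_)
  rw [Real.norm_of_nonneg (Real.exp_nonneg _), Real.rpow_neg (by positivity), Real.rpow_natCast,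
    ← mul_inv, ← mul_pow, Real.exp_neg]
  refine inv_anti₀ (by positivity) ?_
  have h1 : δ * (1 + ‖x‖) ≤ Real.exp (a / (n + 1) * ‖x‖) := by
    refine le_trans ?_ (Real.add_one_le_exp _)
    have := mul_le_mul_of_nonneg_right (min_le_right 1 (a / (n + 1 : ℝ))) (norm_nonneg x)
    have := min_le_left 1 (a / (n + 1 : ℝ))
    linarith
  refine (pow_le_pow_left₀ (by positivity) h1 (n + 1)).trans_eq ?_
  rw [← Real.exp_nat_mul]
  congr 1
  push_cast
  field_simp

/-! ### Entropy plus potential energy as a relative entropy -/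

section Density

open InformationTheory

variable {n : ℕ} {μ : Measure (EuclideanSpace ℝ (Fin n))}

lemma density_nonneg (μ : Measure (EuclideanSpace ℝ (Fin n))) (x : EuclideanSpace ℝ (Fin n)) :
    0 ≤ density μ x := ENNReal.toReal_nonneg

lemma measurable_density (μ : Measure (EuclideanSpace ℝ (Fin n))) : Measurable (density μ) :=
  (Measure.measurable_rnDeriv _ _).ennreal_toReal

lemma integrable_density_mul [IsFiniteMeasure μ] (hac : μ ≪ volume)
    {f : EuclideanSpace ℝ (Fin n) → ℝ} (hf : Integrable f μ) :
    Integrable fun x => density μ x * f x :=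
  (integrable_rnDeriv_smul_iff hac).2 hf

lemma lintegral_ofReal_density_mul [IsFiniteMeasure μ] (hac : μ ≪ volume)
    {f : EuclideanSpace ℝ (Fin n) → ℝ} (hf : Measurable f) :
    ∫⁻ x, ENNReal.ofReal (density μ x * f x) = ∫⁻ x, ENNReal.ofReal (f x) ∂μ := by
  rw [← lintegral_rnDeriv_mul hac hf.ennreal_ofReal.aemeasurable]
  refine lintegral_congr_ae ?_
  filter_upwards [μ.rnDeriv_lt_top volume] with x hx
  rw [ENNReal.ofReal_mul (density_nonneg μ x), density, ENNReal.ofReal_toReal hx.ne]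

lemma extIntegral_density_mul [IsFiniteMeasure μ] (hac : μ ≪ volume)
    {f : EuclideanSpace ℝ (Fin n) → ℝ} (hf : Measurable f) :
    extIntegral volume (fun x => density μ x * f x) = extIntegral μ f := by
  simp only [extIntegral, ← mul_neg]
  rw [lintegral_ofReal_density_mul hac hf,
    lintegral_ofReal_density_mul hac (f := fun x => -f x) hf.neg]

lemma integral_density [IsProbabilityMeasure μ] (hac : μ ≪ volume) : ∫ x, density μ x = 1 := by
  have := integral_rnDeriv_smul (f := fun _ => (1 : ℝ)) hac
  simpa [density] using this

lemma integrable_entropy_minorant (hμ : μ ∈ P2 n) (hac : μ ≪ volume) :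
    Integrable fun x => -(density μ x * ‖x‖ + Real.exp (-(1 * ‖x‖))) := by
  have := hμ.1
  exact ((integrable_density_mul hac (integrable_norm_of_mem_P2 hμ)).add
    (integrable_exp_neg_mul_norm one_pos)).neg

/-- Fenchel-Young at `s = -|x|`. The minorant is integrable on `P2` because first moments are finite
there, so the entropy is never `∞ - ∞`. -/
lemma entropy_minorant_le (μ : Measure (EuclideanSpace ℝ (Fin n))) (x : EuclideanSpace ℝ (Fin n)) :
    -(density μ x * ‖x‖ + Real.exp (-(1 * ‖x‖))) ≤ density μ x * Real.log (density μ x) := by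
  have h := mul_le_klFun_add_exp (density_nonneg μ x) (-(1 * ‖x‖))
  rw [klFun_apply] at h
  linarith [density_nonneg μ x]

lemma aestronglyMeasurable_density_mul_log (μ : Measure (EuclideanSpace ℝ (Fin n))) :
    AEStronglyMeasurable (fun x => density μ x * Real.log (density μ x)) :=
  ((measurable_density μ).mul (measurable_density μ).log).aestronglyMeasurable

lemma entropy_ne_bot (hμ : μ ∈ P2 n) : entropy μ ≠ ⊥ := by
  by_cases hac : μ ≪ volume
  · rw [entropy, if_pos hac]
    exact extIntegral_ne_bot (aestronglyMeasurable_density_mul_log μ)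
      (integrable_entropy_minorant hμ hac) (entropy_minorant_le μ)
  · simp [entropy, if_neg hac]

variable {U : EuclideanSpace ℝ (Fin n) → ℝ}

lemma isFiniteMeasure_expNegMeasure (hU : Integrable fun x => Real.exp (-U x)) :
    IsFiniteMeasure (expNegMeasure U) :=
  isFiniteMeasure_withDensity_ofReal hU.2

lemma expNegMeasure_real_univ (hU : Integrable fun x => Real.exp (-U x)) :
    (expNegMeasure U).real Set.univ = ∫ x, Real.exp (-U x) := by
  rw [measureReal_def, expNegMeasure, withDensity_apply _ MeasurableSet.univ,
    Measure.restrict_univ, ← ofReal_integral_eq_lintegral_ofReal hU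
      (ae_of_all _ fun x => Real.exp_nonneg _),
    ENNReal.toReal_ofReal (integral_nonneg fun x => Real.exp_nonneg _)]

lemma expNegMeasure_absolutelyContinuous (U : EuclideanSpace ℝ (Fin n) → ℝ) :
    expNegMeasure U ≪ volume := withDensity_absolutelyContinuous _ _

lemma absolutelyContinuous_expNegMeasure (hUm : Measurable U) : volume ≪ expNegMeasure U :=
  withDensity_absolutelyContinuous' (by fun_prop)
    (ae_of_all _ fun x => by simpa using Real.exp_pos _)

/-- The density of `μ` relative to `exp (-U) dx` is `ρ exp U`, where `ρ` is its Lebesgue density;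
expand `exp (-U) * klFun (ρ exp U)`. -/
lemma klDiv_expNegMeasure_eq_lintegral [IsFiniteMeasure μ] (hac : μ ≪ volume) (hUm : Measurable U)
    (hU : Integrable fun x => Real.exp (-U x)) :
    klDiv μ (expNegMeasure U) = ∫⁻ x, ENNReal.ofReal (density μ x * Real.log (density μ x) +
      density μ x * U x - (density μ x - Real.exp (-U x))) := by
  have := isFiniteMeasure_expNegMeasure hU
  have hm : Measurable fun x => ENNReal.ofReal (Real.exp (-U x)) := by fun_prop
  rw [klDiv_eq_lintegral_klFun_of_ac (hac.trans (absolutelyContinuous_expNegMeasure hUm))]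
  conv_lhs => rw [expNegMeasure]
  rw [lintegral_withDensity_eq_lintegral_mul _ hm (by fun_prop)]
  refine lintegral_congr_ae ?_
  filter_upwards [Measure.rnDeriv_withDensity_right μ volume hm.aemeasurable
    (ae_of_all _ fun x => by simpa using Real.exp_pos _) (ae_of_all _ fun x => by simp)] with x hx
  rw [Pi.mul_apply, hx, ← ENNReal.ofReal_mul (Real.exp_nonneg _), ENNReal.toReal_mul,
    ENNReal.toReal_inv, ENNReal.toReal_ofReal (Real.exp_nonneg _), ← Real.exp_neg, neg_neg]
  congr 1
  change Real.exp (-U x) * klFun (Real.exp (U x) * density μ x) = _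
  have hee : Real.exp (-U x) * Real.exp (U x) = 1 := by rw [← Real.exp_add]; simp
  rcases (density_nonneg μ x).eq_or_lt with h0 | h0
  · rw [← h0]; simp [klFun_zero]
  · rw [klFun_apply, Real.log_mul (Real.exp_pos _).ne' h0.ne', Real.log_exp]
    linear_combination (density μ x * (U x + Real.log (density μ x)) - density μ x) * hee

/-- Entropy plus potential energy is a relative entropy, up to a constant. -/
lemma entropy_add_extIntegral (hμ : μ ∈ P2 n) (hac : μ ≪ volume) (hUm : Measurable U)
    (hU : Integrable fun x => Real.exp (-U x)) {g : EuclideanSpace ℝ (Fin n) → ℝ}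
    (hg : Integrable g μ) (hgU : ∀ x, g x ≤ U x) :
    entropy μ + extIntegral μ U = ((klDiv μ (expNegMeasure U) : ℝ≥0∞) : EReal) +
      ((1 - (expNegMeasure U).real Set.univ : ℝ) : EReal) := by
  have := hμ.1
  have hρ : Integrable (density μ) := by
    simpa using integrable_density_mul hac (integrable_const (1 : ℝ))
  have hmU : AEStronglyMeasurable (fun x => density μ x * U x) :=
    ((measurable_density μ).mul hUm).aestronglyMeasurable
  have hsm : AEStronglyMeasurable fun x =>
      density μ x * Real.log (density μ x) + density μ x * U x :=
    (aestronglyMeasurable_density_mul_log μ).add hmU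
  -- With this minorant the nonnegative remainder is exactly the `klDiv` integrand, and the
  -- minorant's integral is the additive constant.
  have hg' : Integrable fun x => density μ x - Real.exp (-U x) := hρ.sub hU
  have hle : ∀ x, density μ x - Real.exp (-U x) ≤
      density μ x * Real.log (density μ x) + density μ x * U x := fun x => by
    have h := mul_le_klFun_add_exp (density_nonneg μ x) (-U x)
    rw [klFun_apply] at h
    linarith
  rw [entropy, if_pos hac, ← extIntegral_density_mul hac hUm,
    ← extIntegral_add (aestronglyMeasurable_density_mul_log μ) hmU
      (integrable_entropy_minorant hμ hac) (integrable_density_mul hac hg) (entropy_minorant_le μ)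
      (fun x => mul_le_mul_of_nonneg_left (hgU x) (density_nonneg μ x)),
    extIntegral_eq_lintegral_add hsm hg' hle, klDiv_expNegMeasure_eq_lintegral hac hUm hU,
    expNegMeasure_real_univ hU,
    ← integral_density hac, ← integral_sub hρ hU]

end Density

/-! ### Decomposition of the free energy -/

section FreeEnergy

open InformationTheory

variable {n : ℕ} {μ : Measure (EuclideanSpace ℝ (Fin n))} {U V W : EuclideanSpace ℝ (Fin n) → ℝ}

lemma integrable_interaction_minorant (hμ : μ ∈ P2 n) (b k : ℝ) :
    Integrable (fun p => b * ‖p.1 - p.2‖ ^ 2 - k) (μ.prod μ) := by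
  have := hμ.1
  exact ((integrable_norm_sub_sq_prod hμ).const_mul b).sub (integrable_const k)

lemma integral_interaction_minorant (hμ : μ ∈ P2 n) (b k : ℝ) :
    ∫ p, (b * ‖p.1 - p.2‖ ^ 2 - k) ∂(μ.prod μ) =
      b * (2 * ∫ x, ‖x‖ ^ 2 ∂μ - 2 * ‖∫ x, x ∂μ‖ ^ 2) - k := by
  have := hμ.1
  rw [integral_sub ((integrable_norm_sub_sq_prod hμ).const_mul b) (integrable_const k),
    integral_const_mul, integral_norm_sub_sq_prod hμ]
  simp

lemma freeEnergy_ne_bot (hμ : μ ∈ P2 n) (hVm : Continuous V) (hWm : Continuous W) {c k b k' : ℝ}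
    (hV : ∀ x, c * ‖x‖ ^ 2 - k ≤ V x) (hW : ∀ x, b * ‖x‖ ^ 2 - k' ≤ W x) :
    freeEnergy V W μ ≠ ⊥ := by
  by_cases hac : μ ≪ volume
  · rw [freeEnergy, if_pos hac, extIntegral_eq_lintegral_add (f := fun p => W (p.1 - p.2))
      (by fun_prop) (integrable_interaction_minorant hμ b k') (fun p => hW _), half_mul_ereal_add]
    exact EReal.add_ne_bot_iff.2 ⟨EReal.add_ne_bot_iff.2 ⟨entropy_ne_bot hμ,
      extIntegral_ne_bot (by fun_prop) (integrable_quadratic_of_mem_P2 hμ c k) hV⟩,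
      ereal_coe_ennreal_add_coe_ne_bot _ _⟩
  · simp [freeEnergy, if_neg hac]

/-- The part of the free energy in excess of the quadratic lower bounds of the potentials. -/
noncomputable def excessEnergy (U V W : EuclideanSpace ℝ (Fin n) → ℝ) (c k b k' : ℝ)
    (μ : ProbabilityMeasure (EuclideanSpace ℝ (Fin n))) : ℝ≥0∞ :=
  ∫⁻ x, ENNReal.ofReal (V x - U x - (c * ‖x‖ ^ 2 - k)) ∂(μ : Measure (EuclideanSpace ℝ (Fin n))) +
    2⁻¹ * ∫⁻ p, ENNReal.ofReal (W (p.1 - p.2) - (b * ‖p.1 - p.2‖ ^ 2 - k'))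
      ∂((μ : Measure (EuclideanSpace ℝ (Fin n))).prod (μ : Measure (EuclideanSpace ℝ (Fin n))))

/-- The interaction part is the composition of a lower semicontinuous integral with `μ ↦ μ ⊗ μ`,
which is weakly continuous. -/
lemma lowerSemicontinuous_excessEnergy (hUm : Continuous U) (hVm : Continuous V)
    (hWm : Continuous W) (c k b k' : ℝ) :
    LowerSemicontinuous (excessEnergy U V W c k b k') := by
  refine (lowerSemicontinuous_lintegral (by fun_prop)).add ?_
  have h1 : LowerSemicontinuous fun π : ProbabilityMeasure
      (EuclideanSpace ℝ (Fin n) × EuclideanSpace ℝ (Fin n)) =>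
      ∫⁻ p, ENNReal.ofReal (W (p.1 - p.2) - (b * ‖p.1 - p.2‖ ^ 2 - k'))
        ∂(π : Measure (EuclideanSpace ℝ (Fin n) × EuclideanSpace ℝ (Fin n))) :=
    lowerSemicontinuous_lintegral (by fun_prop)
  have h2 : Continuous fun μ : ProbabilityMeasure (EuclideanSpace ℝ (Fin n)) => μ.prod μ :=
    ProbabilityMeasure.continuous_prod.comp (continuous_id.prodMk continuous_id)
  exact (ENNReal.continuous_const_mul (by simp)).comp_lowerSemicontinuous (h1.comp h2)
    fun x y h => mul_le_mul' le_rfl h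

/-- The free energy as a relative entropy plus nonnegative terms plus a quadratic moment term. -/
lemma freeEnergy_eq {μ : ProbabilityMeasure (EuclideanSpace ℝ (Fin n))}
    (hμ : (μ : Measure (EuclideanSpace ℝ (Fin n))) ∈ P2 n)
    (hac : (μ : Measure (EuclideanSpace ℝ (Fin n))) ≪ volume)
    (hUm : Continuous U) (hVm : Continuous V) (hWm : Continuous W)
    (hU : Integrable fun x => Real.exp (-U x)) {e l c k b k' : ℝ}
    (hUl : ∀ x, e * ‖x‖ ^ 2 - l ≤ U x) (hV : ∀ x, c * ‖x‖ ^ 2 - k ≤ V x - U x)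
    (hW : ∀ x, b * ‖x‖ ^ 2 - k' ≤ W x) :
    freeEnergy V W (μ : Measure (EuclideanSpace ℝ (Fin n))) =
      ((klDiv (μ : Measure (EuclideanSpace ℝ (Fin n))) (expNegMeasure U) +
        excessEnergy U V W c k b k' μ : ℝ≥0∞) : EReal) +
      ((1 - (expNegMeasure U).real Set.univ - k - k' / 2 +
        ((c + b) * ∫ x, ‖x‖ ^ 2 ∂(μ : Measure (EuclideanSpace ℝ (Fin n))) -
          b * ‖∫ x, x ∂(μ : Measure (EuclideanSpace ℝ (Fin n)))‖ ^ 2) : ℝ) : EReal) := by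
  have hVU : extIntegral (μ : Measure (EuclideanSpace ℝ (Fin n))) V =
      extIntegral (μ : Measure (EuclideanSpace ℝ (Fin n))) U +
        extIntegral (μ : Measure (EuclideanSpace ℝ (Fin n))) (fun x => V x - U x) := by
    rw [← extIntegral_add (by fun_prop) (by fun_prop) (integrable_quadratic_of_mem_P2 hμ e l)
      (integrable_quadratic_of_mem_P2 hμ c k) hUl hV]
    simp
  rw [freeEnergy, if_pos hac, hVU, ← add_assoc, entropy_add_extIntegral hμ hac hUm.measurable hU
    (integrable_quadratic_of_mem_P2 hμ e l) hUl, extIntegral_eq_lintegral_add (by fun_prop)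
    (integrable_quadratic_of_mem_P2 hμ c k) hV,
    extIntegral_eq_lintegral_add (f := fun p => W (p.1 - p.2))
      (by fun_prop) (integrable_interaction_minorant hμ b k') (fun p => hW _), half_mul_ereal_add,
    integral_quadratic_of_mem_P2 hμ, integral_interaction_minorant hμ, ereal_add_add_add,
    ereal_add_add_add, excessEnergy, add_assoc (klDiv _ _)]
  congr 2
  ring

end FreeEnergy

/-! ### Quadratic lower bound from the Hessian -/

section HessianBound

open Set

/-- A function with Hessian bounded below is bounded below by a quadratic function. -/
lemma HessianGE.exists_quadratic_le {n : ℕ} {V : EuclideanSpace ℝ (Fin n) → ℝ} {α : ℝ}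
    (hV : ContDiff ℝ 2 V) (h : HessianGE V α) : ∃ e l : ℝ, ∀ x, e * ‖x‖ ^ 2 - l ≤ V x := by
  -- Along the segment from `0` to `x`, `V x ≥ V 0 + DV(0) x + α |x|² / 2`; the linear term is
  -- absorbed by `|x| ≤ |x|² + 1`.
  refine ⟨α / 2 - ‖fderiv ℝ V 0‖, ‖fderiv ℝ V 0‖ - V 0, fun x => ?_⟩
  have hV1 : Differentiable ℝ V := hV.differentiable (by norm_num)
  have hV2 : Differentiable ℝ (fderiv ℝ V) :=
    (hV.fderiv_right (m := 1) (by norm_num)).differentiable (by norm_num)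
  have hline : ∀ t : ℝ, HasDerivAt (fun t : ℝ => t • x) x t := fun t => by
    simpa using (hasDerivAt_id t).smul_const x
  let φ : ℝ → ℝ := fun t => V (t • x) - α * ‖x‖ ^ 2 * t ^ 2 / 2
  let ψ : ℝ → ℝ := fun t => fderiv ℝ V (t • x) x - α * ‖x‖ ^ 2 * t
  have hφ : ∀ t, HasDerivAt φ (ψ t) t := fun t => by
    have h1 : HasDerivAt (fun t : ℝ => V (t • x)) (fderiv ℝ V (t • x) x) t :=
      (hV1 (t • x)).hasFDerivAt.comp_hasDerivAt t (hline t)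
    have h2 : HasDerivAt (fun t : ℝ => α * ‖x‖ ^ 2 * t ^ 2 / 2) (α * ‖x‖ ^ 2 * t) t := by
      refine (((hasDerivAt_pow 2 t).const_mul (α * ‖x‖ ^ 2)).div_const 2).congr_deriv ?_
      norm_num
      ring
    exact h1.sub h2
  have hψ : ∀ t, HasDerivAt ψ (fderiv ℝ (fderiv ℝ V) (t • x) x x - α * ‖x‖ ^ 2) t := fun t => by
    have h1 : HasDerivAt (fun t : ℝ => fderiv ℝ V (t • x)) (fderiv ℝ (fderiv ℝ V) (t • x) x) t :=
      (hV2 (t • x)).hasFDerivAt.comp_hasDerivAt t (hline t)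
    have h2 : HasDerivAt (fun t : ℝ => fderiv ℝ V (t • x) x)
        (fderiv ℝ (fderiv ℝ V) (t • x) x x) t :=
      ((ContinuousLinearMap.apply ℝ ℝ x).hasFDerivAt.comp_hasDerivAt t h1)
    have h3 : HasDerivAt (fun t : ℝ => α * ‖x‖ ^ 2 * t) (α * ‖x‖ ^ 2) t := by
      simpa using (hasDerivAt_id t).const_mul (α * ‖x‖ ^ 2)
    exact h2.sub h3
  have hmono : Monotone ψ := by
    refine monotone_of_deriv_nonneg (fun t => (hψ t).differentiableAt) fun t => ?_
    rw [(hψ t).deriv, sub_nonneg]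
    have := h (t • x) x
    rw [iteratedFDeriv_two_apply] at this
    simpa using this
  -- The mean value theorem gives `φ 1 - φ 0 = ψ ξ`, and `ψ ξ ≥ ψ 0 = DV(0) x` by monotonicity.
  obtain ⟨ξ, hξ, hslope⟩ := exists_hasDerivAt_eq_slope φ ψ one_pos
    (fun t _ => (hφ t).continuousAt.continuousWithinAt) fun t _ => hφ t
  have h0 := hmono hξ.1.le
  have hD : -(‖fderiv ℝ V 0‖ * ‖x‖) ≤ fderiv ℝ V 0 x :=
    (abs_le.1 ((fderiv ℝ V 0).le_opNorm x)).1
  simp only [φ, ψ, one_smul, zero_smul] at hslope h0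
  have hDn := norm_nonneg (fderiv ℝ V 0)
  nlinarith [mul_nonneg hDn (sq_nonneg (‖x‖ - 1)), mul_nonneg hDn (sq_nonneg ‖x‖)]

end HessianBound

/-! ### A competitor of finite energy -/

section UniformMeasure

variable {n : ℕ}

lemma extIntegral_congr_ae {α : Type*} [MeasurableSpace α] {μ : Measure α} {f g : α → ℝ}
    (h : f =ᵐ[μ] g) : extIntegral μ f = extIntegral μ g := by
  rw [extIntegral, extIntegral]
  congr 2 <;> refine lintegral_congr_ae ?_ <;> filter_upwards [h] with x hx <;> rw [hx]

lemma enorm_sq_le_of_sub {E : Type*} [SeminormedAddCommGroup E] (x y : E) :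
    ‖x‖ₑ ^ 2 ≤ 2 * ‖x - y‖ₑ ^ 2 + 2 * ‖y‖ₑ ^ 2 := by
  have h : ‖x‖ ^ 2 ≤ 2 * ‖x - y‖ ^ 2 + 2 * ‖y‖ ^ 2 := by
    have := norm_le_norm_sub_add x y
    nlinarith [sq_nonneg (‖x - y‖ - ‖y‖), norm_nonneg x]
  simp only [← ofReal_norm_sq]
  refine (ENNReal.ofReal_le_ofReal h).trans_eq ?_
  rw [ENNReal.ofReal_add (by positivity) (by positivity), ENNReal.ofReal_mul (by positivity),
    ENNReal.ofReal_mul (by positivity)]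
  simp

/-- There is an absolutely continuous measure (uniform on the unit ball) of finite free energy. -/
lemma exists_freeEnergy_ne_top {V W : EuclideanSpace ℝ (Fin n) → ℝ} (hV : Continuous V)
    (hW : Continuous W) : ∃ μ : ProbabilityMeasure (EuclideanSpace ℝ (Fin n)),
      (μ : Measure (EuclideanSpace ℝ (Fin n))) ∈ P2 n ∧
      (μ : Measure (EuclideanSpace ℝ (Fin n))) ≪ volume ∧
      freeEnergy V W (μ : Measure (EuclideanSpace ℝ (Fin n))) ≠ ⊤ := by
  set B : Set (EuclideanSpace ℝ (Fin n)) := Metric.closedBall 0 1 with hB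
  have hBm : MeasurableSet B := Metric.isClosed_closedBall.measurableSet
  have hB0 : volume B ≠ 0 := (Metric.measure_closedBall_pos volume 0 one_pos).ne'
  have hBt : volume B ≠ ∞ := measure_closedBall_lt_top.ne
  set f : EuclideanSpace ℝ (Fin n) → ℝ≥0∞ := B.indicator fun _ => (volume B)⁻¹ with hf
  have hfm : Measurable f := measurable_const.indicator hBm
  set μ := volume.withDensity f with hμ
  have hprob : IsProbabilityMeasure μ := ⟨by
    rw [hμ, withDensity_apply _ MeasurableSet.univ, Measure.restrict_univ, hf,
      lintegral_indicator hBm, setLIntegral_const, ENNReal.inv_mul_cancel hB0 hBt]⟩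
  have hac : μ ≪ volume := withDensity_absolutelyContinuous _ _
  have hae : ∀ᵐ x ∂μ, ‖x‖ ≤ 1 := by
    rw [hμ, ae_withDensity_iff hfm]
    refine ae_of_all _ fun x hx => ?_
    by_contra hcon
    exact hx (Set.indicator_of_notMem (by simpa [hB] using hcon) _)
  have hP2 : μ ∈ P2 n := by
    refine ⟨hprob, lt_of_le_of_lt (lintegral_mono_ae (g := fun _ => 1) ?_) (by simp)⟩
    filter_upwards [hae] with x hx
    rw [← ofReal_norm_sq, ← ENNReal.ofReal_one]
    exact ENNReal.ofReal_le_ofReal (by nlinarith [norm_nonneg x])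
  refine ⟨⟨μ, hprob⟩, hP2, hac, ?_⟩
  have hent : ∃ r : ℝ, entropy μ = r := by
    set c : ℝ := ((volume B)⁻¹).toReal
    have hd : (fun x => density μ x * Real.log (density μ x)) =ᵐ[volume]
        B.indicator fun _ => c * Real.log c := by
      filter_upwards [Measure.rnDeriv_withDensity volume hfm] with x hx
      rw [density, hμ, hx, hf]
      by_cases hxB : x ∈ B <;> simp [hxB, c]
    rw [entropy, if_pos hac, extIntegral_congr_ae hd, extIntegral_eq_integral]
    · exact ⟨_, rfl⟩
    · exact (integrable_indicator_iff hBm).2 (integrableOn_const hBt)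
  have hpot : Integrable V μ := by
    obtain ⟨K, hK⟩ :=
      (isCompact_closedBall (0 : EuclideanSpace ℝ (Fin n)) 1).exists_bound_of_continuousOn
      hV.continuousOn
    refine (integrable_const K).mono' (by fun_prop) ?_
    filter_upwards [hae] with x hx
    exact hK x (by simpa using hx)
  have hint : Integrable (fun p => W (p.1 - p.2)) (μ.prod μ) := by
    obtain ⟨K, hK⟩ :=
      (isCompact_closedBall (0 : EuclideanSpace ℝ (Fin n)) 2).exists_bound_of_continuousOn
      hW.continuousOn
    refine (integrable_const K).mono' (by fun_prop) ?_
    filter_upwards [Measure.quasiMeasurePreserving_fst.ae hae,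
      Measure.quasiMeasurePreserving_snd.ae hae] with p h1 h2
    refine hK _ ?_
    rw [mem_closedBall_zero_iff]
    linarith [norm_sub_le p.1 p.2]
  obtain ⟨r, hr⟩ := hent
  change freeEnergy V W μ ≠ ⊤
  rw [freeEnergy, if_pos hac, hr, extIntegral_eq_integral hpot, extIntegral_eq_integral hint,
    ← EReal.coe_mul, ← EReal.coe_add, ← EReal.coe_add]
  exact EReal.coe_ne_top _

end UniformMeasure

/-! ### Translation invariance without confinement -/

section Translation

variable {n : ℕ} {μ : Measure (EuclideanSpace ℝ (Fin n))} {W : EuclideanSpace ℝ (Fin n) → ℝ}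

lemma extIntegral_map {α β : Type*} [MeasurableSpace α] [MeasurableSpace β] {μ : Measure α}
    {f : α → β} (hf : Measurable f) {g : β → ℝ} (hg : Measurable g) :
    extIntegral (μ.map f) g = extIntegral μ fun x => g (f x) := by
  rw [extIntegral, extIntegral, lintegral_map (by fun_prop) hf, lintegral_map (by fun_prop) hf]

/-- The free energy without confinement is invariant under translations. -/
lemma freeEnergy_zero_map_sub [IsFiniteMeasure μ] (hac : μ ≪ volume) (hW : Continuous W)
    (v : EuclideanSpace ℝ (Fin n)) :
    freeEnergy 0 W (μ.map fun x => x - v) = freeEnergy 0 W μ := by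
  have hm : Measurable fun x : EuclideanSpace ℝ (Fin n) => x - v := by fun_prop
  have hemb : MeasurableEmbedding fun x : EuclideanSpace ℝ (Fin n) => x - v :=
    (MeasurableEquiv.subRight v).measurableEmbedding
  have hvol : (volume : Measure (EuclideanSpace ℝ (Fin n))).map (fun x => x - v) = volume :=
    (measurePreserving_sub_right volume v).map_eq
  have hac' : μ.map (fun x => x - v) ≪ volume := by
    rw [← hvol]; exact hac.map hm
  have hd : ∀ᵐ x, density (μ.map fun x => x - v) (x - v) = density μ x := by
    have := hemb.rnDeriv_map μ volume
    rw [hvol] at this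
    filter_upwards [this] with x hx
    rw [density, density, hx]
  have hent : entropy (μ.map fun x => x - v) = entropy μ := by
    rw [entropy, entropy, if_pos hac, if_pos hac']
    nth_rewrite 1 [← hvol]
    have hmd : Measurable fun x => density (μ.map fun x => x - v) x *
        Real.log (density (μ.map fun x => x - v) x) :=
      (measurable_density _).mul (measurable_density _).log
    rw [extIntegral_map hm hmd]
    refine extIntegral_congr_ae ?_
    filter_upwards [hd] with x hx
    rw [hx]
  have hint : extIntegral ((μ.map fun x => x - v).prod (μ.map fun x => x - v))
      (fun p => W (p.1 - p.2)) = extIntegral (μ.prod μ) fun p => W (p.1 - p.2) := by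
    rw [Measure.map_prod_map _ _ hm hm, extIntegral_map (hm.prodMap hm)
      (by have := hW.measurable; fun_prop)]
    simp
  rw [freeEnergy, freeEnergy, if_pos hac, if_pos hac', hent, hint]
  congr 2
  simp [extIntegral]

lemma map_sub_mem_P2 (hμ : μ ∈ P2 n) (v : EuclideanSpace ℝ (Fin n)) :
    (μ.map fun x => x - v) ∈ P2 n := by
  have := hμ.1
  have hm : Measurable fun x : EuclideanSpace ℝ (Fin n) => x - v := by fun_prop
  refine ⟨Measure.isProbabilityMeasure_map hm.aemeasurable, ?_⟩
  rw [lintegral_map (by fun_prop) hm]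
  refine lt_of_le_of_lt (lintegral_mono fun x => enorm_sq_le_of_sub (x - v) (-v)) ?_
  simp only [sub_neg_eq_add, sub_add_cancel]
  rw [lintegral_add_right _ (by fun_prop), lintegral_const_mul _ (by fun_prop)]
  exact ENNReal.add_lt_top.2 ⟨ENNReal.mul_lt_top (by simp) hμ.2, by
    simpa using ENNReal.mul_lt_top (by simp) (ENNReal.pow_lt_top enorm_lt_top)⟩

lemma integral_map_sub_integral (hμ : μ ∈ P2 n) :
    ∫ x, x ∂(μ.map fun x => x - ∫ y, y ∂μ) = 0 := by
  have := hμ.1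
  rw [integral_map (by fun_prop) (by fun_prop),
    integral_sub (integrable_id_of_mem_P2 hμ) (integrable_const _)]
  simp

end Translation

/-! ### A lower semicontinuous form of the moment term -/

section MomentEnergy

open RealInnerProductSpace

variable {n : ℕ}

/-- The functional `d ∫ |x|² dμ + s |∫ x dμ|²`, as a supremum of lower semicontinuous
functionals. -/
noncomputable def momentEnergy (d s : ℝ)
    (μ : ProbabilityMeasure (EuclideanSpace ℝ (Fin n))) : ℝ≥0∞ :=
  ⨆ v : EuclideanSpace ℝ (Fin n),
    (∫⁻ x, ENNReal.ofReal (d * ‖x + (s / d) • v‖ ^ 2) ∂(μ : Measure (EuclideanSpace ℝ (Fin n))) -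
      ENNReal.ofReal (s ^ 2 / d * ‖v‖ ^ 2 + s * ‖v‖ ^ 2))

lemma lowerSemicontinuous_momentEnergy (d s : ℝ) :
    LowerSemicontinuous (momentEnergy (n := n) d s) :=
  lowerSemicontinuous_iSup fun v =>
    (ENNReal.continuous_sub_right _).comp_lowerSemicontinuous
      (lowerSemicontinuous_lintegral (by fun_prop)) fun _ _ h => tsub_le_tsub_right h _

lemma lintegral_le_momentEnergy (d s : ℝ) (μ : ProbabilityMeasure (EuclideanSpace ℝ (Fin n))) :
    ∫⁻ x, ENNReal.ofReal (d * ‖x‖ ^ 2) ∂(μ : Measure (EuclideanSpace ℝ (Fin n))) ≤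
      momentEnergy d s μ := by
  refine le_iSup_of_le 0 ?_
  simp

lemma mem_P2_of_momentEnergy_ne_top {d s : ℝ} (hd : 0 < d)
    {μ : ProbabilityMeasure (EuclideanSpace ℝ (Fin n))} (h : momentEnergy d s μ ≠ ∞) :
    (μ : Measure (EuclideanSpace ℝ (Fin n))) ∈ P2 n := by
  refine ⟨inferInstance, lt_top_iff_ne_top.2 fun hcon => h (top_unique ?_)⟩
  refine le_trans (le_of_eq ?_) (lintegral_le_momentEnergy d s μ)
  simp_rw [ENNReal.ofReal_mul hd.le, ofReal_norm_sq]
  rw [lintegral_const_mul _ (by fun_prop), hcon, ENNReal.mul_top (by simpa using hd)]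

/-- With `m` the barycenter, `s |m|²` is the supremum over `v` of `s (2⟪v, m⟫ - |v|²)`, attained at
`v = m`. Completing the square turns `d |x|² + 2 s ⟪v, x⟫` into a nonnegative integrand minus a
constant. -/
lemma momentEnergy_eq {d s : ℝ} (hd : 0 < d) (hs : 0 ≤ s)
    {μ : ProbabilityMeasure (EuclideanSpace ℝ (Fin n))}
    (hμ : (μ : Measure (EuclideanSpace ℝ (Fin n))) ∈ P2 n) :
    momentEnergy d s μ = ENNReal.ofReal
      (d * ∫ x, ‖x‖ ^ 2 ∂(μ : Measure (EuclideanSpace ℝ (Fin n))) +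
        s * ‖∫ x, x ∂(μ : Measure (EuclideanSpace ℝ (Fin n)))‖ ^ 2) := by
  set m2 := ∫ x, ‖x‖ ^ 2 ∂(μ : Measure (EuclideanSpace ℝ (Fin n)))
  set m := ∫ x, x ∂(μ : Measure (EuclideanSpace ℝ (Fin n))) with hm
  have hsq := integrable_norm_sq_of_mem_P2 hμ
  have hid := integrable_id_of_mem_P2 hμ
  have key : ∀ v : EuclideanSpace ℝ (Fin n),
      ∫⁻ x, ENNReal.ofReal (d * ‖x + (s / d) • v‖ ^ 2) ∂(μ : Measure (EuclideanSpace ℝ (Fin n))) -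
        ENNReal.ofReal (s ^ 2 / d * ‖v‖ ^ 2 + s * ‖v‖ ^ 2) =
      ENNReal.ofReal (d * m2 + s * (2 * ⟪v, m⟫ - ‖v‖ ^ 2)) := fun v => by
    have hin : Integrable (fun x => ⟪v, x⟫) (μ : Measure (EuclideanSpace ℝ (Fin n))) :=
      hid.const_inner v
    have hexp : ∀ x, d * ‖x + (s / d) • v‖ ^ 2 =
        d * ‖x‖ ^ 2 + 2 * s * ⟪v, x⟫ + s ^ 2 / d * ‖v‖ ^ 2 := fun x => by
      rw [norm_add_sq_real, real_inner_smul_right, norm_smul, mul_pow, Real.norm_eq_abs, sq_abs,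
        real_inner_comm x v]
      field_simp
    have h1 : Integrable (fun x => d * ‖x‖ ^ 2 + 2 * s * ⟪v, x⟫)
        (μ : Measure (EuclideanSpace ℝ (Fin n))) := (hsq.const_mul d).add (hin.const_mul (2 * s))
    have h2 : Integrable (fun x => d * ‖x + (s / d) • v‖ ^ 2)
        (μ : Measure (EuclideanSpace ℝ (Fin n))) := by
      simp_rw [hexp]
      exact h1.add (integrable_const _)
    rw [← ofReal_integral_eq_lintegral_ofReal h2 (ae_of_all _ fun x => by positivity),
      ← ENNReal.ofReal_sub _ (by positivity)]
    simp_rw [hexp]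
    rw [integral_add h1 (integrable_const _), integral_add (hsq.const_mul d)
      (hin.const_mul (2 * s)), integral_const_mul, integral_const_mul, integral_inner hid]
    congr 1
    simp
    ring
  rw [momentEnergy]
  simp_rw [key]
  refine le_antisymm (iSup_le fun v => ENNReal.ofReal_le_ofReal ?_) (le_iSup_of_le m ?_)
  · have h := norm_sub_sq_real v m
    have h' := sq_nonneg ‖v - m‖
    gcongr
    linarith
  · rw [real_inner_self_eq_norm_sq]
    exact ENNReal.ofReal_le_ofReal (by linarith)

end MomentEnergy

/-! ### Existence of minimizers -/

section Minimizers

open InformationTheory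

variable {n : ℕ} {U V W : EuclideanSpace ℝ (Fin n) → ℝ}

/-- By Fubini, `∫ |x - y|² dμ(x)` is finite for some fixed `y`; then compare `|x|²` with `|x - y|²`.
-/
lemma mem_P2_of_lintegral_sub_ne_top {μ : Measure (EuclideanSpace ℝ (Fin n))}
    [IsProbabilityMeasure μ] (h : ∫⁻ p, ‖p.1 - p.2‖ₑ ^ 2 ∂(μ.prod μ) ≠ ∞) : μ ∈ P2 n := by
  rw [lintegral_prod_symm _ (by fun_prop)] at h
  have hm : Measurable fun y => ∫⁻ x, ‖x - y‖ₑ ^ 2 ∂μ :=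
    Measurable.lintegral_prod_left' (f := fun p : EuclideanSpace ℝ (Fin n) ×
      EuclideanSpace ℝ (Fin n) => ‖p.1 - p.2‖ₑ ^ 2) (by fun_prop)
  obtain ⟨y, hy⟩ := (ae_lt_top hm h).exists
  refine ⟨inferInstance, lt_of_le_of_lt (lintegral_mono fun x => enorm_sq_le_of_sub x y) ?_⟩
  rw [lintegral_add_right _ (by fun_prop), lintegral_const_mul _ (by fun_prop)]
  exact ENNReal.add_lt_top.2 ⟨ENNReal.mul_lt_top (by simp) hy, by
    simpa using ENNReal.mul_lt_top (by simp) (ENNReal.pow_lt_top enorm_lt_top)⟩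

lemma mem_P2_of_excessEnergy_ne_top {c k b k' : ℝ} (hb : 0 < b)
    (hW : ∀ x, b * ‖x‖ ^ 2 - k' ≤ W x)
    {μ : ProbabilityMeasure (EuclideanSpace ℝ (Fin n))}
    (h : excessEnergy U V W c k 0 k' μ ≠ ∞) :
    (μ : Measure (EuclideanSpace ℝ (Fin n))) ∈ P2 n := by
  refine mem_P2_of_lintegral_sub_ne_top fun hcon => h ?_
  rw [excessEnergy, ENNReal.add_eq_top]
  right
  rw [ENNReal.mul_eq_top]
  left
  refine ⟨by simp, top_unique ?_⟩
  calc (⊤ : ℝ≥0∞) = ENNReal.ofReal b * ∫⁻ p, ‖p.1 - p.2‖ₑ ^ 2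
        ∂((μ : Measure (EuclideanSpace ℝ (Fin n))).prod
          (μ : Measure (EuclideanSpace ℝ (Fin n)))) := by
        rw [hcon, ENNReal.mul_top (by simpa using hb)]
    _ = ∫⁻ p, ENNReal.ofReal (b * ‖p.1 - p.2‖ ^ 2)
        ∂((μ : Measure (EuclideanSpace ℝ (Fin n))).prod
          (μ : Measure (EuclideanSpace ℝ (Fin n)))) := by
        simp_rw [ENNReal.ofReal_mul hb.le, ofReal_norm_sq]
        rw [lintegral_const_mul _ (by fun_prop)]
    _ ≤ _ := lintegral_mono fun p => ENNReal.ofReal_le_ofReal (by linarith [hW (p.1 - p.2)])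

lemma absolutelyContinuous_of_klDiv_ne_top {μ : Measure (EuclideanSpace ℝ (Fin n))}
    (h : klDiv μ (expNegMeasure U) ≠ ∞) : μ ≪ volume :=
  (klDiv_ne_top_iff.1 h).1.trans (expNegMeasure_absolutelyContinuous U)

lemma freeEnergy_of_not_absolutelyContinuous {μ : Measure (EuclideanSpace ℝ (Fin n))}
    (h : ¬ μ ≪ volume) : freeEnergy V W μ = ⊤ := if_neg h

lemma ereal_coe_ennreal_add_coe_ne_top_iff {x : ℝ≥0∞} {r : ℝ} :
    (x : EReal) + (r : EReal) ≠ ⊤ ↔ x ≠ ∞ := by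
  rw [EReal.add_ne_top_iff_of_ne_bot_of_ne_top (EReal.coe_ne_bot r) (EReal.coe_ne_top r)]
  simp

/-- Existence of minimizers when all quadratic parts vanish, on a closed set `S` which contains
every competitor of smaller energy. -/
lemma exists_minimizer_of_isClosed (hUm : Continuous U) (hVm : Continuous V) (hWm : Continuous W)
    (hU : Integrable fun x => Real.exp (-U x)) {e l k k' : ℝ}
    (hUl : ∀ x, e * ‖x‖ ^ 2 - l ≤ U x) (hV : ∀ x, -k ≤ V x - U x) (hW : ∀ x, -k' ≤ W x)
    (S : ℝ≥0∞ → Set (ProbabilityMeasure (EuclideanSpace ℝ (Fin n))))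
    (hSc : ∀ M, M ≠ ∞ → IsClosed (S M))
    (hSP2 : ∀ M, M ≠ ∞ → ∀ μ ∈ S M, excessEnergy U V W 0 k 0 k' μ ≠ ∞ →
      (μ : Measure (EuclideanSpace ℝ (Fin n))) ∈ P2 n)
    (hmem : ∀ M, M ≠ ∞ → ∀ ν : ProbabilityMeasure (EuclideanSpace ℝ (Fin n)),
      (ν : Measure (EuclideanSpace ℝ (Fin n))) ∈ P2 n →
      klDiv (ν : Measure (EuclideanSpace ℝ (Fin n))) (expNegMeasure U) ≤ M → ν ∈ S M) :
    ∃ μ ∈ P2 n, freeEnergy V W μ ≠ ⊤ ∧ ∀ ν ∈ P2 n, freeEnergy V W μ ≤ freeEnergy V W ν := by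
  have hfin := isFiniteMeasure_expNegMeasure hU
  have hF : ∀ μ : ProbabilityMeasure (EuclideanSpace ℝ (Fin n)),
      (μ : Measure (EuclideanSpace ℝ (Fin n))) ∈ P2 n →
      (μ : Measure (EuclideanSpace ℝ (Fin n))) ≪ volume → _ := fun μ hμ hac =>
    freeEnergy_eq (c := 0) (b := 0) hμ hac hUm hVm hWm hU hUl (by simpa using hV) (by simpa using hW)
  simp only [add_zero, zero_mul, sub_zero] at hF
  obtain ⟨μ₀, hμ₀, hac₀, htop₀⟩ := exists_freeEnergy_ne_top hVm hWm
  rw [hF μ₀ hμ₀ hac₀, ereal_coe_ennreal_add_coe_ne_top_iff] at htop₀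
  set J : ProbabilityMeasure (EuclideanSpace ℝ (Fin n)) → ℝ≥0∞ := fun μ =>
    klDiv (μ : Measure (EuclideanSpace ℝ (Fin n))) (expNegMeasure U) +
      excessEnergy U V W 0 k 0 k' μ with hJ
  change J μ₀ ≠ ∞ at htop₀
  have hkl : ∀ ν : ProbabilityMeasure (EuclideanSpace ℝ (Fin n)),
      klDiv (ν : Measure (EuclideanSpace ℝ (Fin n))) (expNegMeasure U) ≤ J ν :=
    fun ν => le_self_add
  obtain ⟨μ, hμS, hμtop, hmin⟩ := exists_min_klDiv_add (expNegMeasure U)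
    (lowerSemicontinuous_excessEnergy hUm hVm hWm 0 k 0 k') (hSc (J μ₀) htop₀)
    (hmem _ htop₀ μ₀ hμ₀ (hkl μ₀)) htop₀
  have hμP2 := hSP2 _ htop₀ μ hμS (ENNReal.add_ne_top.1 hμtop).2
  have hac := absolutelyContinuous_of_klDiv_ne_top (ENNReal.add_ne_top.1 hμtop).1
  refine ⟨μ, hμP2, ?_, fun ν hν => ?_⟩
  · rw [hF μ hμP2 hac, ereal_coe_ennreal_add_coe_ne_top_iff]
    exact hμtop
  by_cases hνac : ν ≪ volume
  swap
  · rw [freeEnergy_of_not_absolutelyContinuous hνac]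
    exact le_top
  let ν' : ProbabilityMeasure (EuclideanSpace ℝ (Fin n)) := ⟨ν, hν.1⟩
  -- Membership in `S (J μ₀)` is known only for competitors of relative entropy at most `J μ₀`; the
  -- others already lose to `μ₀`.
  have hle : J μ ≤ J ν' := by
    rcases le_total (J ν') (J μ₀) with h | h
    · exact hmin ν' (hmem _ htop₀ ν' hν ((hkl ν').trans h))
    · exact (hmin μ₀ (hmem _ htop₀ μ₀ hμ₀ (hkl μ₀))).trans h
  refine (hF μ hμP2 hac).trans_le (le_trans ?_ (hF ν' hν hνac).ge)
  exact add_le_add (EReal.coe_ennreal_le_coe_ennreal_iff.2 hle) le_rfl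

/-- Existence of minimizers, up to the barycenter, when the quadratic parts of the potentials
are jointly coercive. -/
lemma exists_minimizer_quadratic (hUm : Continuous U) (hVm : Continuous V) (hWm : Continuous W)
    (hU : Integrable fun x => Real.exp (-U x)) {e l c k b k' s : ℝ}
    (hUl : ∀ x, e * ‖x‖ ^ 2 - l ≤ U x) (hV : ∀ x, c * ‖x‖ ^ 2 - k ≤ V x - U x)
    (hW : ∀ x, b * ‖x‖ ^ 2 - k' ≤ W x) (hcb : 0 < c + b) (hs : 0 ≤ s) (hbs : 0 ≤ b + s) :
    ∃ μ ∈ P2 n, freeEnergy V W μ ≠ ⊤ ∧ ∀ ν ∈ P2 n, (b + s) * ‖∫ x, x ∂ν‖ ^ 2 = 0 →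
      freeEnergy V W μ ≤ freeEnergy V W ν := by
  have hfin := isFiniteMeasure_expNegMeasure hU
  set J : ProbabilityMeasure (EuclideanSpace ℝ (Fin n)) → ℝ≥0∞ := fun μ =>
    klDiv (μ : Measure (EuclideanSpace ℝ (Fin n))) (expNegMeasure U) +
      (excessEnergy U V W c k b k' μ + momentEnergy (c + b) s μ) with hJ
  set κ : ℝ := 1 - (expNegMeasure U).real Set.univ - k - k' / 2 with hκ
  -- Adding and subtracting `s |∫ x dμ|²` makes the moment term a `momentEnergy`, up to `-(b + s) |∫
  -- x dμ|²`.
  have hF : ∀ μ : ProbabilityMeasure (EuclideanSpace ℝ (Fin n)),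
      (μ : Measure (EuclideanSpace ℝ (Fin n))) ∈ P2 n →
      (μ : Measure (EuclideanSpace ℝ (Fin n))) ≪ volume →
      freeEnergy V W (μ : Measure (EuclideanSpace ℝ (Fin n))) = ((J μ : ℝ≥0∞) : EReal) +
        ((κ - (b + s) * ‖∫ x, x ∂(μ : Measure (EuclideanSpace ℝ (Fin n)))‖ ^ 2 : ℝ) : EReal) := by
    intro μ hμ hac
    have hnn : 0 ≤ (c + b) * ∫ x, ‖x‖ ^ 2 ∂(μ : Measure (EuclideanSpace ℝ (Fin n))) +
        s * ‖∫ x, x ∂(μ : Measure (EuclideanSpace ℝ (Fin n)))‖ ^ 2 :=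
      add_nonneg (mul_nonneg hcb.le (integral_nonneg fun x => by positivity)) (by positivity)
    rw [freeEnergy_eq hμ hac hUm hVm hWm hU hUl hV hW, hJ]
    simp only
    rw [momentEnergy_eq hcb hs hμ, ← add_assoc, EReal.coe_ennreal_add _ (ENNReal.ofReal _),
      EReal.coe_ennreal_ofReal, max_eq_left hnn, add_assoc, ← EReal.coe_add]
    congr 2
    ring
  obtain ⟨μ₀, hμ₀, hac₀, htop₀⟩ := exists_freeEnergy_ne_top hVm hWm
  rw [hF μ₀ hμ₀ hac₀, ereal_coe_ennreal_add_coe_ne_top_iff] at htop₀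
  obtain ⟨μ, -, hμtop, hmin⟩ := exists_min_klDiv_add (expNegMeasure U)
    ((lowerSemicontinuous_excessEnergy hUm hVm hWm c k b k').add
      (lowerSemicontinuous_momentEnergy (c + b) s)) isClosed_univ (Set.mem_univ μ₀) htop₀
  have hμtop' := ENNReal.add_ne_top.1 hμtop
  have hμP2 := mem_P2_of_momentEnergy_ne_top hcb (ENNReal.add_ne_top.1 hμtop'.2).2
  have hac := absolutelyContinuous_of_klDiv_ne_top hμtop'.1
  refine ⟨μ, hμP2, ?_, fun ν hν hν0 => ?_⟩
  · rw [hF μ hμP2 hac, ereal_coe_ennreal_add_coe_ne_top_iff]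
    exact hμtop
  by_cases hνac : ν ≪ volume
  swap
  · rw [freeEnergy_of_not_absolutelyContinuous hνac]
    exact le_top
  let ν' : ProbabilityMeasure (EuclideanSpace ℝ (Fin n)) := ⟨ν, hν.1⟩
  have hle : J μ ≤ J ν' := hmin ν' (Set.mem_univ _)
  have hF' := hF ν' hν hνac
  change freeEnergy V W ν = ((J ν' : ℝ≥0∞) : EReal) +
    ((κ - (b + s) * ‖∫ x, x ∂ν‖ ^ 2 : ℝ) : EReal) at hF'
  rw [hF μ hμP2 hac, hF', hν0]
  refine add_le_add (EReal.coe_ennreal_le_coe_ennreal_iff.2 hle) (EReal.coe_le_coe_iff.2 ?_)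
  -- The leftover term only lowers the energy of `μ`, so `μ` itself need not be centered.
  have : 0 ≤ (b + s) * ‖∫ x, x ∂(μ : Measure (EuclideanSpace ℝ (Fin n)))‖ ^ 2 := by positivity
  linarith

/-- A Talagrand inequality bounds the second moment in terms of the relative entropy. -/
lemma Talagrand.exists_second_moment_le {C : ℝ} (hC : 0 < C) (hT : Talagrand V C) (hVm : Continuous V)
    (hγ : expNegMeasure V ∈ P2 n) {e l : ℝ} (hVl : ∀ x, e * ‖x‖ ^ 2 - l ≤ V x)
    (hV : Integrable fun x => Real.exp (-V x)) {M : ℝ≥0∞} (hM : M ≠ ∞) :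
    ∃ R : ℝ≥0∞, R ≠ ∞ ∧ ∀ ν ∈ P2 n, klDiv ν (expNegMeasure V) ≤ M →
      ∫⁻ x, ‖x‖ₑ ^ 2 ∂ν ≤ R := by
  have := hγ.1
  -- The `+ 1` makes the bound on the infimum strict, so that some coupling realizes it.
  set T : ℝ≥0∞ := ENNReal.ofReal (2 / C) * M + 1 with hTdef
  have hTtop : T ≠ ∞ :=
    ENNReal.add_ne_top.2 ⟨ENNReal.mul_ne_top ENNReal.ofReal_ne_top hM, ENNReal.one_ne_top⟩
  refine ⟨2 * T + 2 * ∫⁻ y, ‖y‖ₑ ^ 2 ∂expNegMeasure V, ENNReal.add_ne_top.2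
    ⟨ENNReal.mul_ne_top (by simp) hTtop, ENNReal.mul_ne_top (by simp) hγ.2.ne⟩,
    fun ν hν hkl => ?_⟩
  have hac := absolutelyContinuous_of_klDiv_ne_top (ne_top_of_le_ne_top hM hkl)
  have h := hT ν hν
  rw [entropy_add_extIntegral hν hac hVm.measurable hV
    (integrable_quadratic_of_mem_P2 hν e l) hVl] at h
  simp only [probReal_univ, sub_self, EReal.coe_zero, add_zero] at h
  have h1 : wasserstein2 ν (expNegMeasure V) ^ 2 ≤ ENNReal.ofReal (2 / C) * M := by
    rw [← EReal.coe_ennreal_le_coe_ennreal_iff, EReal.coe_ennreal_mul, EReal.coe_ennreal_ofReal,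
      max_eq_left (by positivity)]
    exact h.trans (mul_le_mul_of_nonneg_left (EReal.coe_ennreal_le_coe_ennreal_iff.2 hkl)
      (EReal.coe_nonneg.2 (by positivity)))
  have h2 : wasserstein2 ν (expNegMeasure V) < T ^ (1 / 2 : ℝ) := by
    have : wasserstein2 ν (expNegMeasure V) ^ (2 : ℝ) < T := by
      rw [show (2 : ℝ) = (2 : ℕ) by norm_num, ENNReal.rpow_natCast]
      exact h1.trans_lt (ENNReal.lt_add_right (ENNReal.mul_ne_top ENNReal.ofReal_ne_top hM)
        one_ne_zero)
    have := ENNReal.rpow_lt_rpow this (z := 1 / 2) (by norm_num)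
    rwa [← ENNReal.rpow_mul, show (2 : ℝ) * (1 / 2) = 1 by norm_num, ENNReal.rpow_one] at this
  simp only [wasserstein2, iInf_lt_iff] at h2
  obtain ⟨π, ⟨hfst, hsnd⟩, hπ⟩ := h2
  have h3 : ∫⁻ p, ‖p.1 - p.2‖ₑ ^ 2 ∂π < T := by
    by_contra hcon
    exact absurd (ENNReal.rpow_le_rpow (not_lt.1 hcon) (by norm_num : (0 : ℝ) ≤ 1 / 2))
      (not_le.2 hπ)
  calc ∫⁻ x, ‖x‖ₑ ^ 2 ∂ν = ∫⁻ p, ‖p.1‖ₑ ^ 2 ∂π := by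
        rw [← hfst, Measure.fst, lintegral_map (by fun_prop) measurable_fst]
    _ ≤ ∫⁻ p, (2 * ‖p.1 - p.2‖ₑ ^ 2 + 2 * ‖p.2‖ₑ ^ 2) ∂π :=
        lintegral_mono fun p => enorm_sq_le_of_sub p.1 p.2
    _ = 2 * ∫⁻ p, ‖p.1 - p.2‖ₑ ^ 2 ∂π + 2 * ∫⁻ y, ‖y‖ₑ ^ 2 ∂expNegMeasure V := by
        rw [lintegral_add_right _ (by fun_prop), lintegral_const_mul _ (by fun_prop),
          lintegral_const_mul _ (by fun_prop), ← hsnd, Measure.snd,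
          lintegral_map (by fun_prop) measurable_snd]
    _ ≤ _ := by gcongr

lemma freeEnergy_zero_le_of_forall_centered {μ : Measure (EuclideanSpace ℝ (Fin n))} (hWm : Continuous W)
    (h : ∀ ν ∈ P2 n, ∫ x, x ∂ν = 0 → freeEnergy 0 W μ ≤ freeEnergy 0 W ν) :
    ∀ ν ∈ P2 n, freeEnergy 0 W μ ≤ freeEnergy 0 W ν := by
  intro ν hν
  have := hν.1
  by_cases hac : ν ≪ volume
  · rw [← freeEnergy_zero_map_sub hac hWm (∫ x, x ∂ν)]
    exact h _ (map_sub_mem_P2 hν _) (integral_map_sub_integral hν)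
  · rw [freeEnergy_of_not_absolutelyContinuous hac]
    exact le_top

lemma quadratic_zero_le_mul_norm (a : ℝ) (ha : 0 ≤ a) (x : EuclideanSpace ℝ (Fin n)) :
    0 * ‖x‖ ^ 2 - 0 ≤ a * ‖x‖ := by
  have := norm_nonneg x
  simp only [zero_mul, sub_zero]
  positivity

lemma exists_minimizer_of_quadratic_bounds (hVm : Continuous V) (hWm : Continuous W)
    {a a' b b' s : ℝ} (hV : ∀ x, a * ‖x‖ ^ 2 - a' ≤ V x) (hW : ∀ x, b * ‖x‖ ^ 2 - b' ≤ W x)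
    (hab : 0 < a + b) (hs : 0 ≤ s) (hbs : 0 ≤ b + s) :
    ∃ μ ∈ P2 n, freeEnergy V W μ ≠ ⊤ ∧ ∀ ν ∈ P2 n, (b + s) * ‖∫ x, x ∂ν‖ ^ 2 = 0 →
      freeEnergy V W μ ≤ freeEnergy V W ν := by
  -- Half of the coercivity `a + b` pays for `U`, through `|x| ≤ |x|² + 1`; the other half remains
  -- as `c + b = (a + b) / 2`.
  refine exists_minimizer_quadratic (U := fun x => (a + b) / 2 * ‖x‖) (c := (a - b) / 2)
    (k := a' + (a + b) / 2) (by fun_prop) hVm hWm (integrable_exp_neg_mul_norm (by positivity))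
    (quadratic_zero_le_mul_norm _ (by positivity)) (fun x => ?_) hW (by linarith) hs hbs
  have h1 := hV x
  nlinarith [mul_nonneg hab.le (sq_nonneg (‖x‖ - 1)), mul_nonneg hab.le (sq_nonneg ‖x‖)]

end Minimizers

/-! ### The four cases -/

theorem mainTheorem6 (n : ℕ) (V W : EuclideanSpace ℝ (Fin n) → ℝ) (α β : ℝ)
    (hV : ContDiff ℝ 2 V) (hW : ContDiff ℝ 2 W)
    (hVα : HessianGE V α) (hWβ : HessianGE W β)
    (hWeven : ∀ x, W (-x) = W x)
    (hcases :
      (V = 0 ∧ ConvexOn ℝ Set.univ W ∧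
        ∃ b > (0 : ℝ), ∃ b' > (0 : ℝ), ∀ x, b * ‖x‖ ^ 2 - b' ≤ W x) ∨
      (∃ a > (0 : ℝ), ∃ a' > (0 : ℝ), ∃ b > (0 : ℝ), ∃ b' > (0 : ℝ),
        (∀ x, a * ‖x‖ - a' ≤ V x) ∧ ∀ x, b * ‖x‖ ^ 2 - b' ≤ W x) ∨
      (∃ a > (0 : ℝ), ∃ a' > (0 : ℝ), ∃ b > -a, ∃ b' > (0 : ℝ),
        (∀ x, a * ‖x‖ ^ 2 - a' ≤ V x) ∧ ∀ x, b * ‖x‖ ^ 2 - b' ≤ W x) ∨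
      ((∃ m : ℝ, ∀ x, m ≤ W x) ∧ expNegMeasure V ∈ P2 n ∧ ∃ C > (0 : ℝ), Talagrand V C)) :
    (∀ μ ∈ P2 n, freeEnergy V W μ ≠ ⊥) ∧
      ∃ μ ∈ P2 n, freeEnergy V W μ ≠ ⊤ ∧ ∀ ν ∈ P2 n, freeEnergy V W μ ≤ freeEnergy V W ν := by
  have hVc := hV.continuous
  have hWc := hW.continuous
  obtain ⟨e, l, hVl⟩ := hVα.exists_quadratic_le hV
  obtain ⟨e', l', hWl⟩ := hWβ.exists_quadratic_le hW
  refine ⟨fun μ hμ => freeEnergy_ne_bot hμ hVc hWc hVl hWl, ?_⟩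
  rcases hcases with ⟨rfl, -, b, hb, b', -, hWb⟩ | ⟨a, ha, a', -, b, hb, b', -, hVa, hWb⟩ |
    ⟨a, ha, a', -, b, hb, b', -, hVa, hWb⟩ | ⟨⟨m, hm⟩, hγ, C, hC, hT⟩
  -- With `s = 0` the result covers centered competitors, and recentering reaches the others.
  · obtain ⟨μ, hμ, htop, hmin⟩ := exists_minimizer_of_quadratic_bounds (V := 0) (a := 0) (a' := 0)
      (s := 0) hVc hWc (by simp) hWb (by linarith) le_rfl (by linarith)
    exact ⟨μ, hμ, htop, freeEnergy_zero_le_of_forall_centered hWc fun ν hν h0 => hmin ν hν (by simp [h0])⟩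
  · refine exists_minimizer_of_isClosed (U := fun x => a * ‖x‖) (k := a') (k' := b')
      (by fun_prop) hVc hWc (integrable_exp_neg_mul_norm ha) (quadratic_zero_le_mul_norm _ ha.le)
      (fun x => by linarith [hVa x]) (fun x => ?_) (fun _ => Set.univ) (fun _ _ => isClosed_univ)
      (fun _ _ μ _ h => mem_P2_of_excessEnergy_ne_top hb hWb h) (fun _ _ _ _ _ => Set.mem_univ _)
    have := hWb x
    have : 0 ≤ b * ‖x‖ ^ 2 := by positivity
    linarith
  -- Replacing `b` by `min b 0 ≤ 0` allows `s = -min b 0 ≥ 0`; then `b + s = 0` and no centering is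
  -- needed.
  · have hW0 : ∀ x, min b 0 * ‖x‖ ^ 2 - b' ≤ W x := fun x => by
      have := mul_le_mul_of_nonneg_right (min_le_left b 0) (sq_nonneg ‖x‖)
      linarith [hWb x]
    have hab : 0 < a + min b 0 := by
      rcases min_choice b 0 with h | h <;> rw [h] <;> linarith
    obtain ⟨μ, hμ, htop, hmin⟩ := exists_minimizer_of_quadratic_bounds (s := -min b 0) hVc hWc hVa
      hW0 hab (by simp) (by simp)
    exact ⟨μ, hμ, htop, fun ν hν => hmin ν hν (by simp)⟩
  · have hexp : Integrable fun x => Real.exp (-V x) := by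
      refine (lintegral_ofReal_ne_top_iff_integrable (by fun_prop)
        (ae_of_all _ fun x => Real.exp_nonneg _)).1 ?_
      have := hγ.1
      have h := measure_ne_top (expNegMeasure V) Set.univ
      rwa [expNegMeasure, withDensity_apply _ MeasurableSet.univ, Measure.restrict_univ] at h
    have hex := fun (M : ℝ≥0∞) (hM : M ≠ ∞) =>
      hT.exists_second_moment_le hC hVc hγ hVl hexp hM
    choose R hR hRle using hex
    refine exists_minimizer_of_isClosed (U := V) (k := 0) (k' := -m) hVc hVc hWc hexp hVl
      (fun x => by simp) (fun x => by simpa using hm x)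
      -- A second moment ball, closed by lower semicontinuity; the value `0` at `M = ∞` is never
      -- used.
      (fun M => {μ | ∫⁻ x, ENNReal.ofReal (‖x‖ ^ 2) ∂(μ : Measure (EuclideanSpace ℝ (Fin n))) ≤
        if hM : M ≠ ∞ then R M hM else 0})
      (fun M hM => (lowerSemicontinuous_lintegral (by fun_prop)).isClosed_preimage _)
      (fun M hM μ hμ _ => ⟨inferInstance, ?_⟩) (fun M hM ν hν hkl => ?_)
    · simp only [dif_pos hM, ofReal_norm_sq, Set.mem_ofPred_eq] at hμ
      exact hμ.trans_lt (lt_top_iff_ne_top.2 (hR M hM))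
    · simp only [dif_pos hM, ofReal_norm_sq, Set.mem_ofPred_eq]
      exact hRle M hM ν hν hkl
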